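/- An arrangement of $n$ pseudolines in the Euclidean plane is a collection of $n$ $x$-monotone curves (graphs of continuous functions $\mathbb R\to\mathbb R$) such that any two of them cross exactly once, i.e. they have exactly one common point and change sides there. It is simple if no three pseudolines have a common point. Its faces are the connected components of the complement of the union of the pseudolines, and its edges are the connected components of the pseudolines after removal of the crossing points. A dual path is a nonempty sequence of pairwise distinct faces in which consecutive faces share an edge; its length is the number of its faces. Theorem. (a) There is a constant $C$ such that for every $n\ge 0$ every simple arrangement of $n$ pseudolines has a dual path of length at least $\frac13 n^2-Cn$. (b) There are exponentially many dual paths of quadratic length: there are constants $c>0$, $b>1$ and $n_0$ such that for every $n\ge n_0$ every simple arrangement of $n$ pseudolines has at least $b^n$ dual paths of length at least $cn^2$. (c) The bound in (a) is tight up to lower-order terms, even for straight lines: there is a constant $C$ such that for every $n\ge 1$ there is a simple arrangement of $n$ straight lines in which every dual path has length at most $\frac13 n^2+Cn$. -/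

import Mathlib

/-- Two functions `ℝ → ℝ`, seen as `x`-monotone curves, cross exactly once: they have exactly one
common point, and there they change sides. -/
def CrossExactlyOnce (f g : ℝ → ℝ) : Prop :=
  ∃ x₀ : ℝ, f x₀ = g x₀ ∧
    (((∀ x, x < x₀ → f x < g x) ∧ (∀ x, x₀ < x → g x < f x)) ∨
      ((∀ x, x < x₀ → g x < f x) ∧ (∀ x, x₀ < x → f x < g x)))

/-- A (Euclidean) arrangement of `n` pseudolines: `n` bi-infinite `x`-monotone curves in the plane
(graphs of continuous functions), each two of which cross exactly once. -/
structure PseudolineArrangement (n : ℕ) where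
  /-- The function whose graph is the `i`-th pseudoline. -/
  curve : Fin n → ℝ → ℝ
  continuous_curve : ∀ i, Continuous (curve i)
  cross : ∀ i j, i ≠ j → CrossExactlyOnce (curve i) (curve j)

namespace PseudolineArrangement

variable {n : ℕ} (A : PseudolineArrangement n)

/-- The arrangement is simple: no three pseudolines have a common point. -/
def IsSimple : Prop :=
  ∀ i j k : Fin n, i ≠ j → i ≠ k → j ≠ k →
    ¬ ∃ x : ℝ, A.curve i x = A.curve j x ∧ A.curve i x = A.curve k x

/-- All the pseudolines are straight lines. -/
def IsLineArrangement : Prop :=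
  ∀ i, ∃ a b : ℝ, ∀ x, A.curve i x = a * x + b

/-- The `i`-th pseudoline, as a subset of the plane. -/
def pseudoline (i : Fin n) : Set (ℝ × ℝ) := {p | p.2 = A.curve i p.1}

/-- The part of the plane that no pseudoline covers. -/
def uncovered : Set (ℝ × ℝ) := {p | ∀ i, p ∉ A.pseudoline i}

/-- The `i`-th pseudoline without the vertices on it. -/
def openPart (i : Fin n) : Set (ℝ × ℝ) := {p | p ∈ A.pseudoline i ∧ ∀ j, j ≠ i → p ∉ A.pseudoline j}

/-- The faces are the connected components of the complement of the union of the pseudolines. -/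
def IsFace (F : Set (ℝ × ℝ)) : Prop :=
  ∃ p ∈ A.uncovered, F = connectedComponentIn A.uncovered p

/-- The edges are the connected components of the pseudolines with the vertices removed. -/
def IsEdge (e : Set (ℝ × ℝ)) : Prop :=
  ∃ i, ∃ p ∈ A.openPart i, e = connectedComponentIn (A.openPart i) p

/-- The type of faces. -/
def Face : Type := {F : Set (ℝ × ℝ) // A.IsFace F}

/-- The dual graph: its vertices are the faces, and two different faces are adjacent if they share
an edge, that is, some edge of the arrangement lies on the boundary of both. -/
def dualGraph : SimpleGraph A.Face where
  Adj F G := F ≠ G ∧ ∃ e, A.IsEdge e ∧ e ⊆ frontier F.1 ∧ e ⊆ frontier G.1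
  symm := ⟨fun _ _ h => ⟨h.1.symm, h.2.imp fun _ he => ⟨he.1, he.2.2, he.2.1⟩⟩⟩
  loopless := ⟨fun _ h => h.1 rfl⟩

/-- A dual path: a nonempty sequence of faces in which consecutive faces share an edge and no face
appears more than once. Its length is the number of its faces, `P.length`. -/
def IsDualPath (P : List A.Face) : Prop :=
  P ≠ [] ∧ P.IsChain A.dualGraph.Adj ∧ P.Nodup

end PseudolineArrangement

/-!
The level of a face is the number of pseudolines below it. The faces of level `k` are linearly
ordered from left to right and separated by the crossings of level `k`, those with `k - 1`
pseudolines below them; at such a crossing there is one face of level `k + 1` above it and one of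
level `k - 1` below it, and both of them are adjacent to the faces to the left and to the right of
the crossing. So there is one face per crossing, up to one more for each level.

*Long paths.* In the band of the levels `k - 1`, `k`, `k + 1` there is a dual path from left to right
through all the faces of level `k`: at every crossing of level `k` it uses the face above or the face
below the crossing to get to the next face. One of the two is always new, since a bounded face has at
least three edges: between two crossings of level `k` there is a crossing of level `k + 1` or `k - 1`
(`exists_vertex_between`). This path has two faces per crossing of level `k`. The bands
`k = r, r + 3, r + 6, …` are traversed alternately from left to right and from right to left
(`Layers.exists_snake`), and for the best `r` there are at least a third of the `n (n - 1) / 2`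
crossings on their middle levels. To get from a band to the next one, the path has to leave through
the unbounded face of level `k + 1` and must not visit it before. Therefore it leaves as soon as this
face is above it (`Layers.exists_path_across`). What it misses are the crossings of level `k` beyond
all crossings of level `k + 1`; each of them is determined by the pseudoline on its outer upper side,
so that there are only `n` of them at either end (`sum_card_rightmost_le`).

*Many paths.* If every other band of the snake is always traversed, then the path is still long, and
the side from which to do it can be chosen for each of these bands independently.

*Tightness.* Levels of adjacent faces differ in parity, so a dual path has at most about twice as many
faces as there are crossings of levels of a given parity (`length_dualPath_le`). For the lines
`x cos u + y sin u = cos (3 u)`, on the crossing of the lines with angles `s` and `t` the position of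
the line with angle `u` is given by the sign of `sin (u - s) sin (u - t) cos (u + s + t)`
(`tangent_identity`). For equidistant angles this sign shows that a crossing has a level of the rare
parity only if the zero of `cos (u + s + t)` is between `s` and `t`. The three zeros of the product
play symmetric roles, so this happens for a third of the crossings only
(`six_mul_card_crossings_le`).
-/

open Filter Topology

/-! ### Faces and levels -/

/-- A function that is locally constant on a preconnected set is constant there. -/
theorem IsPreconnected.eq_of_eventually_eq {X Y : Type*} [TopologicalSpace X] {s : Set X}
    (hs : IsPreconnected s) (f : X → Y) (h : ∀ x ∈ s, ∀ᶠ y in 𝓝 x, f y = f x) {x y : X}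
    (hx : x ∈ s) (hy : y ∈ s) : f x = f y := by
  let _ : TopologicalSpace Y := ⊥
  have _ : DiscreteTopology Y := ⟨rfl⟩
  refine hs.constant (f := f) (fun z hz => ?_) hx hy
  have hc : ContinuousAt f z :=
    (continuousAt_const (y := f z)).congr ((h z hz).mono fun _ hy => hy.symm)
  exact hc.continuousWithinAt

namespace PseudolineArrangement

variable {n : ℕ} (A : PseudolineArrangement n)

/-- The indices of the pseudolines that pass below the point `(x, y)`. -/
noncomputable def lower (x y : ℝ) : Finset (Fin n) :=
  Finset.univ.filter fun i => A.curve i x < y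

/-- The indices of the pseudolines through the point `(x, y)`. -/
noncomputable def through (x y : ℝ) : Finset (Fin n) :=
  Finset.univ.filter fun i => A.curve i x = y

variable {A}

theorem mem_through {x y : ℝ} {i : Fin n} : i ∈ A.through x y ↔ A.curve i x = y := by
  simp [through]

theorem mem_lower {x y : ℝ} {i : Fin n} : i ∈ A.lower x y ↔ A.curve i x < y := by
  simp [lower]

theorem mem_uncovered {x y : ℝ} : (x, y) ∈ A.uncovered ↔ ∀ i, y ≠ A.curve i x := by
  simp [uncovered, pseudoline]

theorem lower_mono {x y y' : ℝ} (h : y ≤ y') : A.lower x y ⊆ A.lower x y' := fun _ hi =>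
  mem_lower.2 ((mem_lower.1 hi).trans_le h)

theorem lower_eq_of_card_eq {x y y' : ℝ} (h : (A.lower x y).card = (A.lower x y').card) :
    A.lower x y = A.lower x y' := by
  rcases le_total y y' with hy | hy
  · exact Finset.eq_of_subset_of_card_le (lower_mono hy) h.ge
  · exact (Finset.eq_of_subset_of_card_le (lower_mono hy) h.le).symm

theorem lower_subset_of_card_le {x y y' : ℝ} (h : (A.lower x y).card ≤ (A.lower x y').card) :
    A.lower x y ⊆ A.lower x y' := by
  rcases le_total y y' with hy | hy
  · exact lower_mono hy
  · exact (Finset.eq_of_subset_of_card_le (lower_mono hy) h).ge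

theorem card_lower_le (x y : ℝ) : (A.lower x y).card ≤ n := by
  simpa using Finset.card_le_univ (A.lower x y)

theorem eventually_uncovered {p : ℝ × ℝ} (hp : p ∈ A.uncovered) :
    ∀ᶠ q in 𝓝 p, q ∈ A.uncovered ∧ A.lower q.1 q.2 = A.lower p.1 p.2 := by
  obtain ⟨x, y⟩ := p
  rw [mem_uncovered] at hp
  have key : ∀ i, ∀ᶠ q : ℝ × ℝ in 𝓝 (x, y),
      q.2 ≠ A.curve i q.1 ∧ (A.curve i q.1 < q.2 ↔ A.curve i x < y) := by
    intro i
    have hc : Continuous fun q : ℝ × ℝ => A.curve i q.1 :=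
      (A.continuous_curve i).comp continuous_fst
    rcases lt_or_gt_of_ne (hp i) with h | h
    · filter_upwards [continuous_snd.continuousAt.eventually_lt hc.continuousAt h] with q hq
      exact ⟨hq.ne, iff_of_false hq.not_gt h.not_gt⟩
    · filter_upwards [hc.continuousAt.eventually_lt continuous_snd.continuousAt h] with q hq
      exact ⟨hq.ne', iff_of_true hq h⟩
  filter_upwards [eventually_all.2 key] with q hq
  refine ⟨?_, ?_⟩
  · obtain ⟨a, b⟩ := q
    exact mem_uncovered.2 fun i => (hq i).1
  · ext i
    simp only [mem_lower, (hq i).2]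

theorem isOpen_uncovered : IsOpen A.uncovered :=
  isOpen_iff_mem_nhds.2 fun _ hp => (eventually_uncovered hp).mono fun _ h => h.1

theorem lower_eq_of_mem_component {p q : ℝ × ℝ} (hp : p ∈ A.uncovered)
    (hq : q ∈ connectedComponentIn A.uncovered p) : A.lower q.1 q.2 = A.lower p.1 p.2 :=
  isPreconnected_connectedComponentIn.eq_of_eventually_eq
    (fun q : ℝ × ℝ => A.lower q.1 q.2)
    (fun _ hr => (eventually_uncovered (connectedComponentIn_subset _ _ hr)).mono fun _ h => h.2)
    hq (mem_connectedComponentIn hp)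

/-- Two uncovered points on a vertical line with equally many pseudolines below them lie in the
same face. -/
theorem component_eq_of_card_eq {x y y' : ℝ} (hy : (x, y) ∈ A.uncovered)
    (hy' : (x, y') ∈ A.uncovered) (h : (A.lower x y).card = (A.lower x y').card) :
    connectedComponentIn A.uncovered (x, y) = connectedComponentIn A.uncovered (x, y') := by
  wlog hle : y ≤ y' generalizing y y'
  · exact (this hy' hy h.symm (le_of_not_ge hle)).symm
  have hl := lower_eq_of_card_eq h
  rw [mem_uncovered] at hy hy'
  have hsub : (fun t : ℝ => (x, t)) '' Set.Icc y y' ⊆ A.uncovered := by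
    rintro _ ⟨t, ht, rfl⟩
    refine mem_uncovered.2 fun i hi => ?_
    have hi' : i ∈ A.lower x y' :=
      mem_lower.2 (lt_of_le_of_ne (hi ▸ ht.2) fun he => hy' i he.symm)
    rw [← hl] at hi'
    exact absurd (mem_lower.1 hi') (not_lt.2 (hi ▸ ht.1))
  have hpre : IsPreconnected ((fun t : ℝ => (x, t)) '' Set.Icc y y') :=
    isPreconnected_Icc.image _ (by fun_prop)
  have := hpre.subset_connectedComponentIn ⟨y, ⟨le_rfl, hle⟩, rfl⟩ hsub
  exact connectedComponentIn_eq (this ⟨y', ⟨hle, le_rfl⟩, rfl⟩)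

variable (A)

/-- The abscissas over which there is a face with exactly `k` pseudolines below it. -/
def gap (k : ℕ) : Set ℝ := {x | ∃ y, (x, y) ∈ A.uncovered ∧ (A.lower x y).card = k}

theorem exists_uncovered_top (x : ℝ) : ∃ y, (x, y) ∈ A.uncovered ∧ (A.lower x y).card = n := by
  obtain ⟨M, hM⟩ := (Set.finite_range fun i => A.curve i x).bddAbove
  have h : ∀ i, A.curve i x < M + 1 := fun i =>
    (hM ⟨i, rfl⟩).trans_lt (lt_add_one M)
  refine ⟨M + 1, mem_uncovered.2 fun i => (h i).ne', ?_⟩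
  have : A.lower x (M + 1) = Finset.univ := by
    ext i
    simp [mem_lower, h i]
  simp [this]

open Classical in
/-- The height of an uncovered point over `x` with exactly `k` pseudolines below it; for
`x ∉ A.gap k` the height of some point above all the pseudolines. -/
noncomputable def height (k : ℕ) (x : ℝ) : ℝ :=
  if h : x ∈ A.gap k then h.choose else (A.exists_uncovered_top x).choose

theorem height_mem (k : ℕ) (x : ℝ) : (x, A.height k x) ∈ A.uncovered := by
  unfold height
  split_ifs with h
  · exact h.choose_spec.1
  · exact (A.exists_uncovered_top x).choose_spec.1

/-- The pseudolines below the face of level `k` over `x`. -/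
noncomputable def below (k : ℕ) (x : ℝ) : Finset (Fin n) := A.lower x (A.height k x)

/-- The face of level `k` over `x`, that is, the one with `k` pseudolines below it (a junk face if
`x ∉ A.gap k`). -/
noncomputable def face (k : ℕ) (x : ℝ) : A.Face :=
  ⟨connectedComponentIn A.uncovered (x, A.height k x), _, A.height_mem k x, rfl⟩

/-- The number of pseudolines below a face. -/
noncomputable def level (F : A.Face) : ℕ := (A.lower F.2.choose.1 F.2.choose.2).card

variable {A}

theorem card_below {k : ℕ} {x : ℝ} (h : x ∈ A.gap k) : (A.below k x).card = k := by
  unfold below height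
  rw [dif_pos h]
  exact h.choose_spec.2

theorem gap_le {k : ℕ} {x : ℝ} (h : x ∈ A.gap k) : k ≤ n :=
  card_below h ▸ card_lower_le _ _

theorem lower_eq_below {k : ℕ} {x y : ℝ} (hy : (x, y) ∈ A.uncovered)
    (hk : (A.lower x y).card = k) : A.lower x y = A.below k x :=
  lower_eq_of_card_eq (hk.trans (card_below ⟨y, hy, hk⟩).symm)

theorem face_eq {k : ℕ} {x y : ℝ} (hy : (x, y) ∈ A.uncovered) (hk : (A.lower x y).card = k) :
    (A.face k x).1 = connectedComponentIn A.uncovered (x, y) :=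
  component_eq_of_card_eq (A.height_mem k x) hy ((card_below ⟨y, hy, hk⟩).trans hk.symm)

theorem level_eq {F : A.Face} {p : ℝ × ℝ} (hp : p ∈ F.1) :
    A.level F = (A.lower p.1 p.2).card := by
  have h := F.2.choose_spec
  have hp' : p ∈ connectedComponentIn A.uncovered F.2.choose := by
    rw [← h.2]; exact hp
  rw [level, lower_eq_of_mem_component h.1 hp']

theorem mem_uncovered_of_mem_face {F : A.Face} {p : ℝ × ℝ} (hp : p ∈ F.1) : p ∈ A.uncovered := by
  obtain ⟨F, q, hq, rfl⟩ := F
  exact connectedComponentIn_subset _ _ hp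

theorem eq_face_of_mem {F : A.Face} {p : ℝ × ℝ} (hp : p ∈ F.1) :
    F = A.face (A.level F) p.1 := by
  apply Subtype.ext
  rw [face_eq (y := p.2) (mem_uncovered_of_mem_face hp) (level_eq hp).symm]
  obtain ⟨F, q, hq, rfl⟩ := F
  exact connectedComponentIn_eq hp

theorem height_mem_face (k : ℕ) (x : ℝ) : (x, A.height k x) ∈ (A.face k x).1 :=
  mem_connectedComponentIn (A.height_mem k x)

theorem level_face {k : ℕ} {x : ℝ} (h : x ∈ A.gap k) : A.level (A.face k x) = k := by
  rw [level_eq (height_mem_face k x)]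
  exact card_below h

theorem fst_mem_gap {F : A.Face} {p : ℝ × ℝ} (hp : p ∈ F.1) : p.1 ∈ A.gap (A.level F) :=
  ⟨p.2, mem_uncovered_of_mem_face hp, (level_eq hp).symm⟩

theorem exists_eq_face (F : A.Face) : ∃ x ∈ A.gap (A.level F), F = A.face (A.level F) x := by
  obtain ⟨p, hp, hF⟩ := F.2
  have hp' : p ∈ F.1 := hF ▸ mem_connectedComponentIn hp
  exact ⟨p.1, fst_mem_gap hp', eq_face_of_mem hp'⟩

theorem eventually_face_eq {k : ℕ} {x : ℝ} (h : x ∈ A.gap k) :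
    ∀ᶠ x' in 𝓝 x, x' ∈ A.gap k ∧ A.face k x' = A.face k x ∧ A.below k x' = A.below k x := by
  have hc : Tendsto (fun x' : ℝ => (x', A.height k x)) (𝓝 x) (𝓝 (x, A.height k x)) :=
    Continuous.tendsto (by fun_prop) x
  have hopen : (A.face k x).1 ∈ 𝓝 (x, A.height k x) :=
    (isOpen_uncovered.connectedComponentIn).mem_nhds (height_mem_face k x)
  filter_upwards [hc (eventually_uncovered (A.height_mem k x)), hc hopen] with x' h1 h2
  have hk : (A.lower x' (A.height k x)).card = k := by
    rw [h1.2]; exact card_below h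
  refine ⟨⟨_, h1.1, hk⟩, ?_, ?_⟩
  · apply Subtype.ext
    rw [face_eq h1.1 hk]
    exact (connectedComponentIn_eq h2).symm
  · rw [← lower_eq_below h1.1 hk, h1.2]; rfl

theorem face_eq_of_Icc_subset {k : ℕ} {x y : ℝ} (hxy : x ≤ y) (h : Set.Icc x y ⊆ A.gap k) :
    A.face k x = A.face k y :=
  isPreconnected_Icc.eq_of_eventually_eq (A.face k)
    (fun _ hz => (eventually_face_eq (h hz)).mono fun _ h' => h'.2.1)
    (Set.left_mem_Icc.2 hxy) (Set.right_mem_Icc.2 hxy)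

theorem below_eq_of_Icc_subset {k : ℕ} {x y : ℝ} (hxy : x ≤ y) (h : Set.Icc x y ⊆ A.gap k) :
    A.below k x = A.below k y :=
  isPreconnected_Icc.eq_of_eventually_eq (A.below k)
    (fun _ hz => (eventually_face_eq (h hz)).mono fun _ h' => h'.2.2)
    (Set.left_mem_Icc.2 hxy) (Set.right_mem_Icc.2 hxy)

/-- A face projects to an interval, so faces of level `k` on the two sides of a point outside
`A.gap k` are different. -/
theorem face_ne_of_not_mem_gap {k : ℕ} {x v y : ℝ} (hxv : x ≤ v) (hvy : v ≤ y)
    (hx : x ∈ A.gap k) (hv : v ∉ A.gap k) : A.face k x ≠ A.face k y := by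
  intro he
  have hpre : IsPreconnected (Prod.fst '' (A.face k x).1) :=
    isPreconnected_connectedComponentIn.image _ continuous_fst.continuousOn
  have hmem : v ∈ Prod.fst '' (A.face k x).1 :=
    hpre.ordConnected.out ⟨_, height_mem_face k x, rfl⟩
      ⟨_, he ▸ height_mem_face k y, rfl⟩ ⟨hxv, hvy⟩
  obtain ⟨p, hp, rfl⟩ := hmem
  have := fst_mem_gap hp
  rw [level_face hx] at this
  exact hv this

theorem disjoint_lower_through (x y : ℝ) : Disjoint (A.lower x y) (A.through x y) :=
  Finset.disjoint_left.2 fun _ h h' => (mem_lower.1 h).ne (mem_through.1 h')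

theorem lower_union_through_subset {x y y' : ℝ} (h : y < y') :
    A.lower x y ∪ A.through x y ⊆ A.lower x y' := by
  intro i hi
  rcases Finset.mem_union.1 hi with hi | hi
  · exact lower_mono h.le hi
  · exact mem_lower.2 ((mem_through.1 hi).trans_lt h)

/-- Close to any point there are uncovered points vertically below and above it; the pseudolines
through the point are the ones between them. -/
theorem exists_uncovered_near (x y : ℝ) {ε : ℝ} (hε : 0 < ε) :
    ∃ y₁ y₂, (y - ε < y₁ ∧ y₁ < y) ∧ (y < y₂ ∧ y₂ < y + ε) ∧
      (x, y₁) ∈ A.uncovered ∧ (x, y₂) ∈ A.uncovered ∧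
      A.lower x y₁ = A.lower x y ∧ A.lower x y₂ = A.lower x y ∪ A.through x y := by
  have key : ∀ j, ∀ᶠ z in 𝓝 y,
      A.curve j x ≠ y → (z ≠ A.curve j x ∧ (A.curve j x < z ↔ A.curve j x < y)) := by
    intro j
    rcases lt_trichotomy (A.curve j x) y with h | h | h
    · filter_upwards [eventually_gt_nhds h] with z hz _
      exact ⟨hz.ne', iff_of_true hz h⟩
    · exact Eventually.of_forall fun z hz => absurd h hz
    · filter_upwards [eventually_lt_nhds h] with z hz _
      exact ⟨hz.ne, iff_of_false hz.not_gt h.not_gt⟩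
  obtain ⟨δ, hδ, hball⟩ := Metric.eventually_nhds_iff.1 (eventually_all.2 key)
  obtain ⟨m, hm, hmm⟩ := exists_between (lt_min hδ hε)
  obtain ⟨hm1, hm2⟩ := lt_min_iff.1 hmm
  have h1 := @hball (y - m) (by
    rw [Real.dist_eq, abs_lt]; constructor <;> linarith)
  have h2 := @hball (y + m) (by
    rw [Real.dist_eq, abs_lt]; constructor <;> linarith)
  refine ⟨y - m, y + m, ⟨by linarith, by linarith⟩, ⟨by linarith, by linarith⟩,
    mem_uncovered.2 fun j hj => ?_, mem_uncovered.2 fun j hj => ?_, ?_, ?_⟩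
  · exact (h1 j (by intro h; linarith)).1 hj
  · exact (h2 j (by intro h; linarith)).1 hj
  · ext j
    by_cases hji : A.curve j x = y
    · simp only [mem_lower]; constructor <;> intro h' <;> linarith
    · simp only [mem_lower, (h1 j hji).2]
  · ext j
    by_cases hji : A.curve j x = y
    · simp only [mem_lower, mem_through, Finset.mem_union, hji, or_true, iff_true]; linarith
    · simp only [mem_lower, mem_through, Finset.mem_union, (h2 j hji).2, hji, or_false]

end PseudolineArrangement

/-! ### Adjacent faces, and crossings -/

namespace PseudolineArrangement

variable {n : ℕ} {A : PseudolineArrangement n}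

theorem mem_openPart {i : Fin n} {x y : ℝ} :
    (x, y) ∈ A.openPart i ↔ A.through x y = {i} := by
  simp only [openPart, pseudoline, Set.mem_ofPred_eq, Finset.ext_iff, mem_through,
    Finset.mem_singleton]
  constructor
  · rintro ⟨h, h'⟩ j
    exact ⟨fun hj => by_contra fun hne => h' j hne hj.symm, fun hj => hj ▸ h.symm⟩
  · intro h
    exact ⟨((h i).2 rfl).symm, fun j hj h' => hj ((h j).1 h'.symm)⟩

theorem mem_gap_of_mem_openPart {i : Fin n} {x y : ℝ} (h : (x, y) ∈ A.openPart i) :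
    x ∈ A.gap (A.lower x y).card ∧ x ∈ A.gap ((A.lower x y).card + 1) := by
  obtain ⟨y₁, y₂, -, -, h1, h2, h3, h4⟩ := A.exists_uncovered_near x y one_pos
  refine ⟨⟨y₁, h1, by rw [h3]⟩, ⟨y₂, h2, ?_⟩⟩
  rw [h4, Finset.card_union_of_disjoint (disjoint_lower_through x y), mem_openPart.1 h,
    Finset.card_singleton]

/-- A point in the relative interior of an edge lies on the boundary of the face below it and of
the face above it. -/
theorem mem_frontier_of_mem_openPart {i : Fin n} {x y : ℝ} (h : (x, y) ∈ A.openPart i) :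
    (x, y) ∈ frontier (A.face (A.lower x y).card x).1 ∧
      (x, y) ∈ frontier (A.face ((A.lower x y).card + 1) x).1 := by
  have hnot : ∀ F : A.Face, (x, y) ∉ interior F.1 := fun F hF =>
    mem_uncovered.1 (mem_uncovered_of_mem_face (interior_subset hF)) i h.1
  have key : ∀ ε > 0, ∃ y₁ y₂, |y₁ - y| < ε ∧ |y₂ - y| < ε ∧
      (x, y₁) ∈ (A.face (A.lower x y).card x).1 ∧
      (x, y₂) ∈ (A.face ((A.lower x y).card + 1) x).1 := by
    intro ε hε
    obtain ⟨y₁, y₂, ha, hb, h1, h2, h3, h4⟩ := A.exists_uncovered_near x y hε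
    refine ⟨y₁, y₂, abs_lt.2 ⟨by linarith, by linarith⟩, abs_lt.2 ⟨by linarith, by linarith⟩, ?_, ?_⟩
    · rw [face_eq h1 (by rw [h3])]
      exact mem_connectedComponentIn h1
    · rw [face_eq h2 (by
        rw [h4, Finset.card_union_of_disjoint (disjoint_lower_through x y), mem_openPart.1 h,
          Finset.card_singleton])]
      exact mem_connectedComponentIn h2
  refine ⟨⟨Metric.mem_closure_iff.2 fun ε hε => ?_, hnot _⟩,
    ⟨Metric.mem_closure_iff.2 fun ε hε => ?_, hnot _⟩⟩
  · obtain ⟨y₁, y₂, h1, h2, h3, h4⟩ := key ε hε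
    exact ⟨_, h3, by simpa [Prod.dist_eq, Real.dist_eq, abs_sub_comm y] using h1⟩
  · obtain ⟨y₁, y₂, h1, h2, h3, h4⟩ := key ε hε
    exact ⟨_, h4, by simpa [Prod.dist_eq, Real.dist_eq, abs_sub_comm y] using h2⟩

/-- The faces above and below an edge do not change along the edge. -/
theorem eq_of_mem_edge {i : Fin n} {p q : ℝ × ℝ} (hp : p ∈ A.openPart i)
    (hq : q ∈ connectedComponentIn (A.openPart i) p) :
    A.lower q.1 q.2 = A.lower p.1 p.2 ∧
      A.face (A.lower p.1 p.2).card q.1 = A.face (A.lower p.1 p.2).card p.1 ∧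
      A.face ((A.lower p.1 p.2).card + 1) q.1 = A.face ((A.lower p.1 p.2).card + 1) p.1 := by
  set J : Set ℝ := Prod.fst '' connectedComponentIn (A.openPart i) p with hJ
  have hpre : IsPreconnected J :=
    isPreconnected_connectedComponentIn.image _ continuous_fst.continuousOn
  have hpJ : p.1 ∈ J := ⟨p, mem_connectedComponentIn hp, rfl⟩
  have hsub : ∀ r ∈ connectedComponentIn (A.openPart i) p, r.2 = A.curve i r.1 ∧
      (r.1, A.curve i r.1) ∈ A.openPart i := by
    intro r hr
    have h := connectedComponentIn_subset _ _ hr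
    have h1 : r.2 = A.curve i r.1 := h.1
    exact ⟨h1, by rw [← h1]; exact h⟩
  have hlow : ∀ x ∈ J, A.lower x (A.curve i x) = A.lower p.1 (A.curve i p.1) := by
    intro x hx
    refine hpre.eq_of_eventually_eq (fun x => A.lower x (A.curve i x)) (fun z hz => ?_) hx hpJ
    obtain ⟨r, hr, rfl⟩ := hz
    have hr' := mem_openPart.1 (hsub r hr).2
    have key : ∀ j, ∀ᶠ z in 𝓝 r.1,
        (A.curve j z < A.curve i z ↔ A.curve j r.1 < A.curve i r.1) := by
      intro j
      rcases lt_trichotomy (A.curve j r.1) (A.curve i r.1) with h | h | h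
      · filter_upwards [(A.continuous_curve j).continuousAt.eventually_lt
          (A.continuous_curve i).continuousAt h] with z hz
        exact iff_of_true hz h
      · have hj : j ∈ A.through r.1 (A.curve i r.1) := mem_through.2 h
        rw [hr', Finset.mem_singleton] at hj
        subst hj
        simp
      · filter_upwards [(A.continuous_curve i).continuousAt.eventually_lt
          (A.continuous_curve j).continuousAt h] with z hz
        exact iff_of_false hz.not_gt h.not_gt
    filter_upwards [eventually_all.2 key] with z hz
    ext j
    simp only [mem_lower, hz j]
  have hp2 := (hsub p (mem_connectedComponentIn hp)).1
  have hgap : ∀ x ∈ J, x ∈ A.gap (A.lower p.1 p.2).card ∧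
      x ∈ A.gap ((A.lower p.1 p.2).card + 1) := by
    intro x hx
    have hl := hlow x hx
    obtain ⟨r, hr, rfl⟩ := hx
    rw [hp2, ← hl]
    exact mem_gap_of_mem_openPart (hsub r hr).2
  have hqJ : q.1 ∈ J := ⟨q, hq, rfl⟩
  refine ⟨?_, ?_, ?_⟩
  · rw [(hsub q hq).1, hp2]
    exact hlow _ hqJ
  · exact hpre.eq_of_eventually_eq (A.face _)
      (fun z hz => (eventually_face_eq (hgap z hz).1).mono fun _ h => h.2.1) hqJ hpJ
  · exact hpre.eq_of_eventually_eq (A.face _)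
      (fun z hz => (eventually_face_eq (hgap z hz).2).mono fun _ h => h.2.1) hqJ hpJ

theorem adj_face {k : ℕ} {x : ℝ} (h : x ∈ A.gap k) (h' : x ∈ A.gap (k + 1)) :
    A.dualGraph.Adj (A.face k x) (A.face (k + 1) x) := by
  have hsub : A.below k x ⊆ A.below (k + 1) x :=
    lower_subset_of_card_le (by
      have h1 := card_below h
      have h2 := card_below h'
      unfold below at h1 h2
      omega)
  obtain ⟨i, hi, hins⟩ : ∃ i, i ∉ A.below k x ∧ A.below (k + 1) x = insert i (A.below k x) := by
    have hc : (A.below (k + 1) x \ A.below k x).card = 1 := by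
      rw [Finset.card_sdiff_of_subset hsub, card_below h, card_below h']; omega
    obtain ⟨i, hi⟩ := Finset.card_eq_one.1 hc
    have hi' : i ∈ A.below (k + 1) x \ A.below k x := by rw [hi]; simp
    refine ⟨i, (Finset.mem_sdiff.1 hi').2, ?_⟩
    rw [Finset.insert_eq, ← hi, Finset.sdiff_union_of_subset hsub]
  have hlt : A.height k x < A.curve i x :=
    lt_of_le_of_ne (not_lt.1 fun hlt => hi (mem_lower.2 hlt))
      (mem_uncovered.1 (A.height_mem k x) i)
  have hlt' : A.curve i x < A.height (k + 1) x :=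
    mem_lower.1 (show i ∈ A.below (k + 1) x by rw [hins]; simp)
  have hlow : A.lower x (A.curve i x) = A.below k x := by
    refine Finset.Subset.antisymm (fun j hj => ?_) (lower_mono hlt.le)
    have hj' : j ∈ A.below (k + 1) x := lower_mono hlt'.le hj
    rw [hins, Finset.mem_insert] at hj'
    rcases hj' with rfl | hj'
    · exact absurd (mem_lower.1 hj) (lt_irrefl _)
    · exact hj'
  have hq : (x, A.curve i x) ∈ A.openPart i := by
    refine mem_openPart.2 (Finset.Subset.antisymm (fun j hj => ?_) (fun j hj => ?_))
    · have hj' : j ∈ A.below (k + 1) x := mem_lower.2 ((mem_through.1 hj).trans_lt hlt')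
      rw [hins, Finset.mem_insert] at hj'
      rcases hj' with rfl | hj'
      · simp
      · exact absurd ((mem_lower.1 hj').trans hlt) (mem_through.1 hj).not_lt
    · rw [Finset.mem_singleton.1 hj]
      exact mem_through.2 rfl
  have hcard : (A.lower x (A.curve i x)).card = k := by rw [hlow, card_below h]
  refine ⟨fun he => ?_, _, ⟨i, _, hq, rfl⟩, fun q hqe => ?_, fun q hqe => ?_⟩
  · have := congrArg A.level he
    rw [level_face h, level_face h'] at this
    omega
  all_goals
    obtain ⟨h1, h2, h3⟩ := eq_of_mem_edge hq hqe
    have h4 := mem_frontier_of_mem_openPart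
      (show (q.1, q.2) ∈ A.openPart i from connectedComponentIn_subset _ _ hqe)
    simp only [h1, hcard] at h2 h3 h4
  · rw [← h2]; exact h4.1
  · rw [← h3]; exact h4.2

theorem eq_face_of_mem_closure {i : Fin n} {x y : ℝ} (h : (x, y) ∈ A.openPart i) {F : A.Face}
    (hF : (x, y) ∈ closure F.1) :
    F = A.face (A.lower x y).card x ∨ F = A.face ((A.lower x y).card + 1) x := by
  obtain ⟨hg, hg'⟩ := mem_gap_of_mem_openPart h
  have hfst : Tendsto (Prod.fst : ℝ × ℝ → ℝ) (𝓝 (x, y)) (𝓝 x) := continuous_fst.tendsto _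
  have key : ∀ j, ∀ᶠ q : ℝ × ℝ in 𝓝 (x, y),
      j ≠ i → (A.curve j q.1 < q.2 ↔ A.curve j x < y) := by
    intro j
    have hc : Continuous fun q : ℝ × ℝ => A.curve j q.1 :=
      (A.continuous_curve j).comp continuous_fst
    rcases lt_trichotomy (A.curve j x) y with hj | hj | hj
    · filter_upwards [hc.continuousAt.eventually_lt continuous_snd.continuousAt hj] with q hq _
      exact iff_of_true hq hj
    · have : j ∈ A.through x y := mem_through.2 hj
      rw [mem_openPart.1 h, Finset.mem_singleton] at this
      exact Eventually.of_forall fun _ hne => absurd this hne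
    · filter_upwards [continuous_snd.continuousAt.eventually_lt hc.continuousAt hj] with q hq _
      exact iff_of_false hq.not_gt hj.not_gt
  have hi : i ∉ A.lower x y := by
    rw [mem_lower]; exact (show y = A.curve i x from h.1) ▸ lt_irrefl _
  obtain ⟨q, hqF, ⟨hq1, hq2⟩, hq3⟩ := ((mem_closure_iff_frequently.1 hF).and_eventually
    (((hfst.eventually (eventually_face_eq hg)).and (hfst.eventually (eventually_face_eq hg'))).and
      (eventually_all.2 key))).exists
  have hFq := eq_face_of_mem hqF
  rw [level_eq hqF] at hFq
  by_cases hiq : A.curve i q.1 < q.2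
  · right
    have : A.lower q.1 q.2 = insert i (A.lower x y) := by
      ext j
      by_cases hj : j = i
      · subst hj; simp [mem_lower, hiq]
      · simp [mem_lower, hq3 j hj, hj]
    rw [this, Finset.card_insert_of_notMem hi] at hFq
    rw [hFq]; exact hq2.2.1
  · left
    have : A.lower q.1 q.2 = A.lower x y := by
      ext j
      by_cases hj : j = i
      · subst hj; simp only [mem_lower] at hi ⊢; exact iff_of_false hiq hi
      · simp [mem_lower, hq3 j hj]
    rw [this] at hFq
    rw [hFq]; exact hq1.2.1

/-- The levels of adjacent faces have different parity. -/
theorem even_level_iff_of_adj {F G : A.Face} (h : A.dualGraph.Adj F G) :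
    Even (A.level F) ↔ ¬ Even (A.level G) := by
  obtain ⟨hne, e, ⟨i, ⟨x, y⟩, hp, rfl⟩, h1, h2⟩ := h
  have hpe := mem_connectedComponentIn hp
  obtain ⟨hg, hg'⟩ := mem_gap_of_mem_openPart hp
  rcases eq_face_of_mem_closure hp (h1 hpe).1 with rfl | rfl <;>
    rcases eq_face_of_mem_closure hp (h2 hpe).1 with rfl | rfl
  · exact absurd rfl hne
  · rw [level_face hg, level_face hg', Nat.even_add_one, not_not]
  · rw [level_face hg, level_face hg', Nat.even_add_one]
  · exact absurd rfl hne

theorem curve_eq_unique {i j : Fin n} (hij : i ≠ j) {x x' : ℝ}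
    (h : A.curve i x = A.curve j x) (h' : A.curve i x' = A.curve j x') : x = x' := by
  obtain ⟨x₀, -, ⟨h1, h2⟩ | ⟨h1, h2⟩⟩ := A.cross i j hij
  all_goals
    have key : ∀ z, A.curve i z = A.curve j z → z = x₀ := by
      intro z hz
      rcases lt_trichotomy z x₀ with hlt | rfl | hlt
      · exact absurd hz (by first | exact (h1 z hlt).ne | exact (h1 z hlt).ne')
      · rfl
      · exact absurd hz (by first | exact (h2 z hlt).ne | exact (h2 z hlt).ne')
    exact (key x h).trans (key x' h').symm

variable (A) in
open Classical in
/-- The abscissa of the crossing of two different pseudolines (with the junk value `0` on the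
diagonal). -/
noncomputable def crossing (p : Fin n × Fin n) : ℝ :=
  if h : p.1 ≠ p.2 then (A.cross p.1 p.2 h).choose else 0

theorem curve_crossing {p : Fin n × Fin n} (h : p.1 ≠ p.2) :
    A.curve p.1 (A.crossing p) = A.curve p.2 (A.crossing p) := by
  rw [crossing, dif_pos h]
  exact (A.cross p.1 p.2 h).choose_spec.1

variable (n) in
/-- The pairs `(i, j)` with `i < j`; each stands for the crossing of two pseudolines. -/
def pairs : Finset (Fin n × Fin n) := Finset.univ.filter fun p => p.1 < p.2

variable (A) in
/-- The level of a crossing: the level of the faces to its left and right, which is one more than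
the number of pseudolines below the crossing. -/
noncomputable def crossingLevel (p : Fin n × Fin n) : ℕ :=
  (A.lower (A.crossing p) (A.curve p.1 (A.crossing p))).card + 1

variable (A) in
/-- The abscissas of the crossings of level `k`. -/
noncomputable def vertices (k : ℕ) : Finset ℝ :=
  ((pairs n).filter fun p => A.crossingLevel p = k).image A.crossing

theorem mem_vertices {k : ℕ} {x : ℝ} : x ∈ A.vertices k ↔
    ∃ i j, i ≠ j ∧ A.curve i x = A.curve j x ∧ (A.lower x (A.curve i x)).card + 1 = k := by
  simp only [vertices, Finset.mem_image, Finset.mem_filter, pairs, Finset.mem_univ, true_and]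
  constructor
  · rintro ⟨⟨i, j⟩, ⟨hij, hk⟩, rfl⟩
    exact ⟨i, j, hij.ne, curve_crossing (p := (i, j)) hij.ne, hk⟩
  · rintro ⟨i, j, hij, hx, hk⟩
    wlog hlt : i < j generalizing i j
    · exact this j i hij.symm hx.symm (by rw [← hx]; exact hk)
        (lt_of_le_of_ne (not_lt.1 hlt) hij.symm)
    have : A.crossing (i, j) = x := curve_eq_unique hij (curve_crossing (p := (i, j)) hij) hx
    refine ⟨(i, j), ⟨hlt, ?_⟩, this⟩
    rw [crossingLevel, this]
    exact hk

theorem card_add_two_le_of_lt {x y y' : ℝ} {i j : Fin n} (hij : i ≠ j)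
    (hi : A.curve i x = y) (hj : A.curve j x = y) (hy : y < y') :
    (A.lower x y).card + 2 ≤ (A.lower x y').card := by
  have h := Finset.card_le_card (lower_union_through_subset (A := A) (x := x) hy)
  rw [Finset.card_union_of_disjoint (disjoint_lower_through x y)] at h
  have h2 : ({i, j} : Finset (Fin n)) ⊆ A.through x y := by
    intro l hl
    rcases Finset.mem_insert.1 hl with rfl | hl
    · exact mem_through.2 hi
    · rw [Finset.mem_singleton.1 hl]; exact mem_through.2 hj
  have := Finset.card_le_card h2
  rw [Finset.card_pair hij] at this
  omega

theorem not_mem_gap_of_mem_vertices {k : ℕ} {x : ℝ} (h : x ∈ A.vertices k) : x ∉ A.gap k := by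
  obtain ⟨i, j, hij, hx, hk⟩ := mem_vertices.1 h
  rintro ⟨y, hy, hyk⟩
  rcases lt_or_gt_of_ne (mem_uncovered.1 hy i) with hlt | hlt
  · have := Finset.card_le_card (lower_mono (A := A) (x := x) hlt.le)
    omega
  · have := card_add_two_le_of_lt hij rfl hx.symm hlt
    omega

theorem mem_gap_of_not_mem_vertices (hA : A.IsSimple) {k : ℕ} (hk : k ≤ n) {x : ℝ}
    (h : x ∉ A.vertices k) : x ∈ A.gap k := by
  rcases Nat.eq_zero_or_pos k with rfl | hpos
  · obtain ⟨m, hm⟩ := (Set.finite_range fun i => A.curve i x).bddBelow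
    have hlt : ∀ i, m - 1 < A.curve i x := fun i => (sub_one_lt m).trans_le (hm ⟨i, rfl⟩)
    refine ⟨m - 1, mem_uncovered.2 fun i => (hlt i).ne, ?_⟩
    rw [Finset.card_eq_zero, Finset.eq_empty_iff_forall_notMem]
    exact fun i hi => (mem_lower.1 hi).not_gt (hlt i)
  -- the highest pseudoline over `x` that has fewer than `k` pseudolines below it
  set S : Finset (Fin n) := Finset.univ.filter fun i => (A.lower x (A.curve i x)).card < k with hS
  have hne : S.Nonempty := by
    obtain ⟨i, -, hi⟩ := Finset.exists_min_image (Finset.univ : Finset (Fin n))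
      (fun i => A.curve i x) ⟨⟨0, by omega⟩, Finset.mem_univ _⟩
    refine ⟨i, Finset.mem_filter.2 ⟨Finset.mem_univ _, ?_⟩⟩
    rw [Finset.card_eq_zero.2]
    · exact hpos
    · rw [Finset.eq_empty_iff_forall_notMem]
      exact fun j hj => (mem_lower.1 hj).not_ge (hi j (Finset.mem_univ _))
  obtain ⟨i, hi, hmax⟩ := Finset.exists_max_image S (fun i => A.curve i x) hne
  have hik := (Finset.mem_filter.1 hi).2
  obtain ⟨y₁, y₂, -, -, -, h2, -, h4⟩ := A.exists_uncovered_near x (A.curve i x) one_pos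
  have hcard : k ≤ (A.lower x y₂).card := by
    rw [h4]
    by_contra hlt
    have hne' : (Finset.univ \ (A.lower x (A.curve i x) ∪ A.through x (A.curve i x))).Nonempty := by
      rw [← Finset.card_pos, Finset.card_sdiff_of_subset (Finset.subset_univ _), Finset.card_univ,
        Fintype.card_fin]
      omega
    obtain ⟨j, hj, hmin⟩ := Finset.exists_min_image _ (fun i => A.curve i x) hne'
    simp only [Finset.mem_sdiff, Finset.mem_univ, true_and, Finset.mem_union, mem_lower,
      mem_through, not_or, not_lt] at hj hmin
    have hsub : A.lower x (A.curve j x) ⊆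
        A.lower x (A.curve i x) ∪ A.through x (A.curve i x) := by
      intro l hl
      by_contra hl'
      simp only [Finset.mem_union, mem_lower, mem_through, not_or, not_lt] at hl'
      exact (mem_lower.1 hl).not_ge (hmin l hl')
    have hjS : j ∈ S := Finset.mem_filter.2
      ⟨Finset.mem_univ _, (Finset.card_le_card hsub).trans_lt (not_le.1 hlt)⟩
    exact hj.2 (le_antisymm (hmax j hjS) hj.1)
  refine ⟨y₂, h2, le_antisymm ?_ hcard⟩
  by_contra hgt
  rw [h4, Finset.card_union_of_disjoint (disjoint_lower_through _ _)] at hgt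
  by_cases h3 : (A.through x (A.curve i x)).card ≤ 2
  · have h2' : (A.through x (A.curve i x)).card = 2 := by omega
    obtain ⟨a, b, hab, habeq⟩ := Finset.card_eq_two.1 h2'
    have ha : a ∈ A.through x (A.curve i x) := by rw [habeq]; simp
    have hb : b ∈ A.through x (A.curve i x) := by rw [habeq]; simp
    rw [mem_through] at ha hb
    exact h (mem_vertices.2 ⟨a, b, hab, ha.trans hb.symm, by rw [ha]; omega⟩)
  · obtain ⟨a, b, c, ha, hb, hc, hab, hac, hbc⟩ := Finset.two_lt_card_iff.1 (not_le.1 h3)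
    rw [mem_through] at ha hb hc
    exact hA a b c hab hac hbc ⟨x, ha.trans hb.symm, ha.trans hc.symm⟩

theorem mem_gap_iff (hA : A.IsSimple) {k : ℕ} (hk : k ≤ n) {x : ℝ} :
    x ∈ A.gap k ↔ x ∉ A.vertices k :=
  ⟨fun h h' => not_mem_gap_of_mem_vertices h' h, mem_gap_of_not_mem_vertices hA hk⟩

end PseudolineArrangement

/-! ### Crossings of neighbouring levels -/

open Classical in
/-- The elements of `s` to the right of all the elements of `t`. -/
noncomputable def Finset.rightOf (s t : Finset ℝ) : Finset ℝ := s.filter fun v => ∀ u ∈ t, u < v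

open Classical in
/-- The elements of `s` to the left of all the elements of `t`. -/
noncomputable def Finset.leftOf (s t : Finset ℝ) : Finset ℝ := s.filter fun v => ∀ u ∈ t, v < u

theorem Finset.mem_rightOf {s t : Finset ℝ} {v : ℝ} :
    v ∈ s.rightOf t ↔ v ∈ s ∧ ∀ u ∈ t, u < v := by
  simp [rightOf]

theorem Finset.mem_leftOf {s t : Finset ℝ} {v : ℝ} :
    v ∈ s.leftOf t ↔ v ∈ s ∧ ∀ u ∈ t, v < u := by
  simp [leftOf]

namespace PseudolineArrangement

variable {n : ℕ} {A : PseudolineArrangement n}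

theorem one_le_of_mem_vertices {k : ℕ} {x : ℝ} (h : x ∈ A.vertices k) : 1 ≤ k ∧ k + 1 ≤ n := by
  obtain ⟨i, j, hij, hx, hk⟩ := mem_vertices.1 h
  have := (card_add_two_le_of_lt hij rfl hx.symm (lt_add_one (A.curve i x))).trans
    (card_lower_le _ _)
  omega

theorem vertices_eq_empty {k : ℕ} (h : n ≤ k) : A.vertices k = ∅ :=
  Finset.eq_empty_of_forall_notMem fun _ hx => by
    have := (one_le_of_mem_vertices hx).2
    omega

theorem not_mem_vertices_succ {k : ℕ} {x : ℝ} (h : x ∈ A.vertices k) :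
    x ∉ A.vertices (k + 1) := by
  intro h'
  obtain ⟨i, j, hij, hx, hk⟩ := mem_vertices.1 h
  obtain ⟨i', j', hij', hx', hk'⟩ := mem_vertices.1 h'
  rcases lt_trichotomy (A.curve i x) (A.curve i' x) with hlt | heq | hlt
  · have := card_add_two_le_of_lt hij rfl hx.symm hlt; omega
  · rw [heq] at hk; omega
  · have := card_add_two_le_of_lt hij' rfl hx'.symm hlt; omega

theorem through_eq_pair (hA : A.IsSimple) {i j : Fin n} (hij : i ≠ j) {x : ℝ}
    (h : A.curve i x = A.curve j x) : A.through x (A.curve i x) = {i, j} := by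
  ext l
  rw [mem_through, Finset.mem_insert, Finset.mem_singleton]
  constructor
  · intro hl
    by_contra hne
    rw [not_or] at hne
    exact hA i j l hij (Ne.symm hne.1) (Ne.symm hne.2) ⟨x, h, hl.symm⟩
  · rintro (rfl | rfl)
    · rfl
    · exact h.symm

theorem crossing_injOn (hA : A.IsSimple) (k : ℕ) :
    Set.InjOn A.crossing ((pairs n).filter fun p => A.crossingLevel p = k : Finset _) := by
  rintro ⟨i, j⟩ hp ⟨i', j'⟩ hp' hx
  rw [Finset.mem_coe, Finset.mem_filter] at hp hp'
  simp only [pairs, Finset.mem_filter, Finset.mem_univ, true_and, crossingLevel] at hp hp'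
  obtain ⟨hij, hk⟩ := hp
  obtain ⟨hij', hk'⟩ := hp'
  have h := curve_crossing (A := A) (p := (i, j)) hij.ne
  have h' := curve_crossing (A := A) (p := (i', j')) hij'.ne
  rw [← hx] at h' hk'
  simp only at h h' hk hk'
  set x := A.crossing (i, j)
  have heq : A.curve i x = A.curve i' x := by
    rcases lt_trichotomy (A.curve i x) (A.curve i' x) with hlt | heq | hlt
    · have := card_add_two_le_of_lt hij.ne rfl h.symm hlt; omega
    · exact heq
    · have := card_add_two_le_of_lt hij'.ne rfl h'.symm hlt; omega
  have h1 := through_eq_pair hA hij.ne h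
  rw [heq, through_eq_pair hA hij'.ne h'] at h1
  have hi : i' ∈ ({i, j} : Finset (Fin n)) := by rw [← h1]; simp
  have hj : j' ∈ ({i, j} : Finset (Fin n)) := by rw [← h1]; simp
  simp only [Finset.mem_insert, Finset.mem_singleton] at hi hj
  rcases hi with rfl | rfl <;> rcases hj with rfl | rfl
  · exact absurd hij' (lt_irrefl _)
  · rfl
  · exact absurd (hij.trans hij') (lt_irrefl _)
  · exact absurd hij' (lt_irrefl _)

theorem card_vertices (hA : A.IsSimple) (k : ℕ) :
    (A.vertices k).card = ((pairs n).filter fun p => A.crossingLevel p = k).card :=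
  Finset.card_image_of_injOn (crossing_injOn hA k)

theorem sum_card_vertices (hA : A.IsSimple) :
    ∑ k ∈ Finset.range n, (A.vertices k).card = (pairs n).card := by
  rw [Finset.card_eq_sum_card_fiberwise (f := A.crossingLevel) (t := Finset.range n)]
  · exact Finset.sum_congr rfl fun k _ => card_vertices hA k
  · intro p hp
    have hp' : p.1 < p.2 := (Finset.mem_filter.1 hp).2
    have : A.crossing p ∈ A.vertices (A.crossingLevel p) :=
      Finset.mem_image.2 ⟨p, Finset.mem_filter.2 ⟨hp, rfl⟩, rfl⟩
    have := (one_le_of_mem_vertices this).2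
    rw [Finset.coe_range, Set.mem_Iio]
    omega

/-- The faces below and above a crossing of level `k + 1` have the levels `k` and `k + 2`, and they
are separated by the two pseudolines that cross. -/
theorem below_eq_of_crossing (hA : A.IsSimple) {k : ℕ} {x : ℝ} {i j : Fin n} (hij : i ≠ j)
    (h : A.curve i x = A.curve j x) (hk : (A.lower x (A.curve i x)).card = k) :
    x ∈ A.gap k ∧ x ∈ A.gap (k + 2) ∧ A.below k x = A.lower x (A.curve i x) ∧
      A.below (k + 2) x = A.lower x (A.curve i x) ∪ {i, j} := by
  obtain ⟨y₁, y₂, -, -, h1, h2, h3, h4⟩ := A.exists_uncovered_near x (A.curve i x) one_pos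
  have hc1 : (A.lower x y₁).card = k := by rw [h3, hk]
  have hc2 : (A.lower x y₂).card = k + 2 := by
    rw [h4, Finset.card_union_of_disjoint (disjoint_lower_through _ _), hk,
      through_eq_pair hA hij h, Finset.card_pair hij]
  refine ⟨⟨y₁, h1, hc1⟩, ⟨y₂, h2, hc2⟩, ?_, ?_⟩
  · rw [← lower_eq_below h1 hc1, h3]
  · rw [← lower_eq_below h2 hc2, h4, through_eq_pair hA hij h]

/-- Between two crossings of the same level there is a crossing of one of the two neighbouring
levels: otherwise the faces between the two crossings form a strip bounded by the same two
pseudolines at both ends, and these would cross twice. -/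
theorem exists_vertex_between (hA : A.IsSimple) {k : ℕ} {v w : ℝ} (hv : v ∈ A.vertices (k + 1))
    (hw : w ∈ A.vertices (k + 1)) (hvw : v < w) :
    ∃ u, v < u ∧ u < w ∧ (u ∈ A.vertices k ∨ u ∈ A.vertices (k + 2)) := by
  by_contra hcon
  push Not at hcon
  have hkn := (one_le_of_mem_vertices hv).2
  obtain ⟨i, j, hij, hx, hk⟩ := mem_vertices.1 hv
  obtain ⟨i', j', hij', hx', hk'⟩ := mem_vertices.1 hw
  obtain ⟨a1, a2, a3, a4⟩ := below_eq_of_crossing hA hij hx (Nat.succ_injective hk)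
  obtain ⟨b1, b2, b3, b4⟩ := below_eq_of_crossing hA hij' hx' (Nat.succ_injective hk')
  have hI : ∀ l, l ≤ n → v ∈ A.gap l → w ∈ A.gap l →
      (∀ u, v < u → u < w → u ∉ A.vertices l) → Set.Icc v w ⊆ A.gap l := by
    rintro l hl h1 h2 h3 u ⟨hu, hu'⟩
    rcases hu.eq_or_lt with rfl | hu
    · exact h1
    rcases hu'.eq_or_lt with rfl | hu'
    · exact h2
    exact (mem_gap_iff hA hl).2 (h3 u hu hu')
  have h1 := below_eq_of_Icc_subset hvw.le
    (hI k (by omega) a1 b1 fun u hu hu' => (hcon u hu hu').1)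
  have h2 := below_eq_of_Icc_subset hvw.le
    (hI (k + 2) (by omega) a2 b2 fun u hu hu' => (hcon u hu hu').2)
  rw [a3, b3] at h1
  rw [a4, b4, ← h1] at h2
  have hnot : ∀ l : Fin n, l ∈ ({i', j'} : Finset (Fin n)) → l ∈ ({i, j} : Finset (Fin n)) := by
    intro l hl
    have hl' : l ∈ A.lower v (A.curve i v) ∪ {i, j} := by
      rw [h2]; exact Finset.mem_union_right _ hl
    refine (Finset.mem_union.1 hl').resolve_left fun hl'' => ?_
    rw [h1] at hl''
    refine Finset.disjoint_left.1 (disjoint_lower_through w (A.curve i' w)) hl'' ?_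
    rw [through_eq_pair hA hij' hx']
    exact hl
  have hi' := hnot i' (by simp)
  have hj' := hnot j' (by simp)
  simp only [Finset.mem_insert, Finset.mem_singleton] at hi' hj'
  have : A.curve i w = A.curve j w := by
    rcases hi' with rfl | rfl <;> rcases hj' with rfl | rfl
    · exact absurd rfl hij'
    · exact hx'
    · exact hx'.symm
    · exact absurd rfl hij'
  exact hvw.ne (curve_eq_unique hij hx this)

theorem vertices_nonempty (hA : A.IsSimple) {k : ℕ} (hk : 1 ≤ k) (hkn : k < n) :
    (A.vertices k).Nonempty := by
  rw [Finset.nonempty_iff_ne_empty]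
  intro hempty
  have hg : ∀ x, x ∈ A.gap k := fun x => (mem_gap_iff hA hkn.le).2 (by simp [hempty])
  have hc := card_below (hg 0)
  obtain ⟨i, hi⟩ := Finset.card_pos.1 (by omega : 0 < (A.below k 0).card)
  obtain ⟨j, hj⟩ : ∃ j, j ∉ A.below k 0 := by
    by_contra hall
    push Not at hall
    rw [Finset.eq_univ_iff_forall.2 hall, Finset.card_univ, Fintype.card_fin] at hc
    omega
  have hij : i ≠ j := fun h => hj (h ▸ hi)
  have hconst : ∀ x, A.below k x = A.below k 0 := fun x =>
    (isPreconnected_univ (α := ℝ)).eq_of_eventually_eq (A.below k)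
      (fun z _ => (eventually_face_eq (hg z)).mono fun _ h => h.2.2) trivial trivial
  have hx := curve_crossing (A := A) (p := (i, j)) hij
  simp only at hx
  rw [← hconst (A.crossing (i, j)), below, mem_lower] at hi hj
  rw [hx] at hi
  exact hj hi

/-- For the crossings of level `k` to the right of all the crossings of level `k + 1`, the
pseudoline `a` on top to the right of the crossing determines the crossing, and even `k`. Indeed,
the `k + 1` lowest pseudolines to the right of such a crossing have no further crossings with the
other ones. The pseudoline `a` is among them, but those above the crossing are not, so `a` does not
cross them any more. -/
theorem sum_card_rightmost_le (hA : A.IsSimple) (m : ℕ) :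
    ∑ k ∈ Finset.range m, ((A.vertices k).rightOf (A.vertices (k + 1))).card
      ≤ n := by
  rw [← Finset.card_sigma]
  have hn : (Finset.univ : Finset (Fin n)).card = n := by simp
  conv_rhs => rw [← hn]
  -- `a` is the pseudoline on top to the right of the crossing with some `b`
  refine Finset.card_le_card_of_forall_subsingleton
    (fun (p : (_ : ℕ) × ℝ) (a : Fin n) => ∃ b, a ≠ b ∧ A.curve a p.2 = A.curve b p.2 ∧
      (A.lower p.2 (A.curve a p.2)).card + 1 = p.1 ∧
      (∀ x < p.2, A.curve a x < A.curve b x) ∧ (∀ x, p.2 < x → A.curve b x < A.curve a x)) ?_ ?_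
  · rintro ⟨k, v⟩ hv
    simp only [Finset.mem_sigma, Finset.mem_rightOf] at hv
    obtain ⟨i, j, hij, hx, hk⟩ := mem_vertices.1 hv.2.1
    obtain ⟨x₀, h0, h'⟩ := A.cross i j hij
    obtain rfl := curve_eq_unique hij hx h0
    rcases h' with ⟨h1, h2⟩ | ⟨h1, h2⟩
    · exact ⟨i, Finset.mem_univ _, j, hij, hx, hk, h1, h2⟩
    · exact ⟨j, Finset.mem_univ _, i, hij.symm, hx.symm, by rw [← hx]; exact hk, h1, h2⟩
  · rintro a - ⟨k, v⟩ ⟨hv, b, hab, hx, hk, hl, hr⟩ ⟨k', v'⟩ ⟨hv', b', hab', hx', hk', hl', hr'⟩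
    simp only [Finset.mem_sigma, Finset.mem_rightOf] at hv hv' hx hk hl hr hx' hk' hl' hr'
    have main : ∀ {k v b k' v' b'}, a ≠ b → a ≠ b' → A.curve a v = A.curve b v →
        A.curve a v' = A.curve b' v' → (A.lower v' (A.curve a v')).card + 1 = k' →
        (∀ x < v, A.curve a x < A.curve b x) → (∀ x, v < x → A.curve b x < A.curve a x) →
        v' ∈ A.vertices k' → (∀ u ∈ A.vertices (k' + 1), u < v') → v' < v →
        v ∈ A.vertices k → False := by
      intro k v b k' v' b' hab hab' hx hx' hk' hl hr hmem hlast hlt hmem'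
      obtain ⟨l, rfl⟩ : ∃ l, k' = l + 1 := ⟨_, hk'.symm⟩
      have hkn := (one_le_of_mem_vertices hmem).2
      obtain ⟨-, a2, -, a4⟩ := below_eq_of_crossing hA hab' hx' (Nat.succ_injective hk')
      have hsub : Set.Icc v' (v + 1) ⊆ A.gap (l + 2) := fun u hu =>
        (mem_gap_iff hA (by omega)).2 fun hu' => (hlast u hu').not_ge hu.1
      have hconst := below_eq_of_Icc_subset (by linarith) hsub
      have ha : a ∈ A.below (l + 2) (v + 1) := by rw [← hconst, a4]; simp
      have hb : b ∉ A.below (l + 2) (v + 1) := by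
        rw [← hconst, a4, ← through_eq_pair hA hab' hx', Finset.mem_union, mem_lower, mem_through,
          not_or]
        have := hl v' hlt
        exact ⟨this.not_gt, this.ne'⟩
      rw [below, mem_lower] at ha hb
      exact hb ((hr (v + 1) (lt_add_one v)).trans ha)
    rcases lt_trichotomy v v' with hlt | heq | hlt
    · exact (main hab' hab hx' hx hk hl' hr' hv.2.1 hv.2.2 hlt hv'.2.1).elim
    · subst heq
      rw [hk] at hk'
      subst hk'
      rfl
    · exact (main hab hab' hx hx' hk' hl hr hv'.2.1 hv'.2.2 hlt hv.2.1).elim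

variable (A) in
/-- The mirror image of an arrangement in the `y`-axis. -/
def mirror : PseudolineArrangement n where
  curve i x := A.curve i (-x)
  continuous_curve i := (A.continuous_curve i).comp continuous_neg
  cross i j hij := by
    obtain ⟨x₀, h0, h⟩ := A.cross i j hij
    refine ⟨-x₀, by simpa using h0, ?_⟩
    rcases h with ⟨h1, h2⟩ | ⟨h1, h2⟩
    · exact Or.inr ⟨fun x hx => h2 _ (by linarith), fun x hx => h1 _ (by linarith)⟩
    · exact Or.inl ⟨fun x hx => h2 _ (by linarith), fun x hx => h1 _ (by linarith)⟩

theorem mem_vertices_mirror {k : ℕ} {x : ℝ} : x ∈ A.mirror.vertices k ↔ -x ∈ A.vertices k := by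
  simp only [mem_vertices]
  rfl

theorem sum_card_leftmost_le (hA : A.IsSimple) (m : ℕ) :
    ∑ k ∈ Finset.range m, ((A.vertices k).leftOf (A.vertices (k + 1))).card
      ≤ n := by
  have hA' : A.mirror.IsSimple := by
    rintro i j k hij hik hjk ⟨x, h1, h2⟩
    exact hA i j k hij hik hjk ⟨-x, h1, h2⟩
  refine le_trans (Finset.sum_le_sum fun k _ => ?_) (sum_card_rightmost_le hA' m)
  refine Finset.card_le_card_of_injOn (fun x => -x) (fun v hv => ?_) neg_injective.injOn
  simp only [Finset.mem_coe, Finset.mem_rightOf, Finset.mem_leftOf, mem_vertices_mirror,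
    neg_neg] at hv ⊢
  exact ⟨hv.1, fun u hu => by have := hv.2 _ hu; linarith⟩

end PseudolineArrangement

/-! ### Dual paths that run through the levels -/

/-- The combinatorial skeleton of an arrangement of `n` pseudolines, as far as long dual paths are
concerned: for every level `k ≤ n` finitely many abscissas `vert k`, and faces of level `k` that
correspond to the gaps between them. -/
structure Layers (Φ : Type*) (R : Φ → Φ → Prop) (n : ℕ) where
  /-- The abscissas that separate the faces of level `k`. -/
  vert : ℕ → Finset ℝ
  /-- The face of level `k` over an abscissa outside `vert k`. -/
  face : ℕ → ℝ → Φ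
  /-- The level of a face. -/
  level : Φ → ℕ
  symm : ∀ {F G}, R F G → R G F
  level_face : ∀ {k x}, k ≤ n → x ∉ vert k → level (face k x) = k
  face_eq : ∀ {k x y}, k ≤ n → x ≤ y → (∀ v ∈ vert k, x ≤ v → y < v) → face k x = face k y
  face_ne : ∀ {k x v y}, k ≤ n → x < v → v < y → v ∈ vert k → x ∉ vert k → y ∉ vert k →
    face k x ≠ face k y
  adj : ∀ {k x}, k + 1 ≤ n → x ∉ vert k → x ∉ vert (k + 1) → R (face k x) (face (k + 1) x)
  not_mem_succ : ∀ {k x}, x ∈ vert k → x ∉ vert (k + 1)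
  between : ∀ {k v w}, v ∈ vert (k + 1) → w ∈ vert (k + 1) → v < w →
    ∃ u, v < u ∧ u < w ∧ (u ∈ vert k ∨ u ∈ vert (k + 2))

theorem Finset.exists_lt_forall_lt (s : Finset ℝ) (v : ℝ) :
    ∃ x < v, ∀ w ∈ s, w < v → w < x := by
  have h : ∀ w ∈ s, ∀ᶠ x in 𝓝[<] v, w < v → w < x := fun w _ => by
    by_cases hw : w < v
    · filter_upwards [Ioo_mem_nhdsLT hw] with x hx _ using hx.1
    · exact Eventually.of_forall fun _ h => absurd h hw
  obtain ⟨x, hx, hxv⟩ := (((Filter.eventually_all_finset s).2 h).and self_mem_nhdsWithin).exists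
  exact ⟨x, hxv, hx⟩

theorem Finset.exists_gt_forall_gt (s : Finset ℝ) (v : ℝ) :
    ∃ x > v, ∀ w ∈ s, v < w → x < w := by
  have h : ∀ w ∈ s, ∀ᶠ x in 𝓝[>] v, v < w → x < w := fun w _ => by
    by_cases hw : v < w
    · filter_upwards [Ioo_mem_nhdsGT hw] with x hx _ using hx.2
    · exact Eventually.of_forall fun _ h => absurd h hw
  obtain ⟨x, hx, hxv⟩ := (((Filter.eventually_all_finset s).2 h).and self_mem_nhdsWithin).exists
  exact ⟨x, hxv, hx⟩

namespace Layers

variable {Φ : Type*} {R : Φ → Φ → Prop} {n : ℕ} (S : Layers Φ R n)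

theorem not_mem_of_mem_succ {k : ℕ} {x : ℝ} (h : x ∈ S.vert (k + 1)) : x ∉ S.vert k :=
  fun h' => S.not_mem_succ h' h

/-- The mirror image. -/
noncomputable def mirror : Layers Φ R n where
  vert k := (S.vert k).image fun x => -x
  face k x := S.face k (-x)
  level := S.level
  symm := S.symm
  level_face {k x} hk hx := S.level_face hk fun h => hx (Finset.mem_image.2 ⟨_, h, neg_neg x⟩)
  face_eq {k x y} hk hxy h := (S.face_eq hk (neg_le_neg hxy) fun v hv hv' => by
    by_contra hlt
    have := h (-v) (Finset.mem_image_of_mem _ hv) (by linarith)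
    linarith).symm
  face_ne {k x v y} hk hxv hvy hv hx hy := by
    obtain ⟨v, hv', rfl⟩ := Finset.mem_image.1 hv
    exact (S.face_ne hk (show -y < v by linarith) (show v < -x by linarith) hv'
      (fun h => hy (Finset.mem_image.2 ⟨_, h, neg_neg y⟩))
      (fun h => hx (Finset.mem_image.2 ⟨_, h, neg_neg x⟩))).symm
  adj {k x} hk hx hx' := S.adj hk (fun h => hx (Finset.mem_image.2 ⟨_, h, neg_neg x⟩))
      (fun h => hx' (Finset.mem_image.2 ⟨_, h, neg_neg x⟩))
  not_mem_succ {k x} h h' := by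
    obtain ⟨v, hv, rfl⟩ := Finset.mem_image.1 h
    obtain ⟨w, hw, hwv⟩ := Finset.mem_image.1 h'
    obtain rfl := neg_injective hwv
    exact S.not_mem_succ hv hw
  between {k v w} hv hw hvw := by
    obtain ⟨v, hv', rfl⟩ := Finset.mem_image.1 hv
    obtain ⟨w, hw', rfl⟩ := Finset.mem_image.1 hw
    obtain ⟨u, h1, h2, h3⟩ := S.between hw' hv' (neg_lt_neg_iff.1 hvw)
    exact ⟨-u, by linarith, by linarith,
      h3.imp (Finset.mem_image_of_mem _) (Finset.mem_image_of_mem _)⟩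

/-- A dual path along level `k + 1` from the left end up to the abscissa `x`, listed from right to
left. It visits all the faces of level `k + 1` on the way; two consecutive ones of them are connected
by the face above or the face below the vertex between them. One of the two is new: by
`Layers.between`, it changed since the previous vertex. At the first vertex the upper one is taken,
so that the lower face at the left end is used as the starting point only. -/
theorem exists_path_along (k : ℕ) (hk : k + 2 ≤ n) {l : ℝ}
    (hl : ∀ j, ∀ v ∈ S.vert j, l < v) (m : ℕ) : ∀ x, l ≤ x → x ∉ S.vert (k + 1) →
    ((S.vert (k + 1)).filter fun v => v < x).card = m →
    ∃ P : List Φ, P.IsChain R ∧ P.Nodup ∧ P.length = 2 + 2 * m ∧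
      P.head? = some (S.face (k + 1) x) ∧ P.getLast? = some (S.face k l) ∧
      ∀ F ∈ P, (∃ y ≤ x, y ∉ S.vert (k + 1) ∧ F = S.face (k + 1) y) ∨
        (∃ w ∈ S.vert (k + 1), w < x ∧ (F = S.face (k + 2) w ∨ F = S.face k w)) ∨
        F = S.face k l := by
  have hlmem : ∀ j, l ∉ S.vert j := fun j h => lt_irrefl _ (hl j l h)
  induction m with
  | zero =>
    intro x hx hxv hm
    have hx' : S.face (k + 1) l = S.face (k + 1) x := by
      refine S.face_eq (by omega) hx fun v hv _ => ?_
      by_contra hlt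
      have : v < x := lt_of_le_of_ne (not_lt.1 hlt) fun h => hxv (h ▸ hv)
      rw [Finset.card_eq_zero] at hm
      exact Finset.notMem_empty v (hm ▸ Finset.mem_filter.2 ⟨hv, this⟩)
    refine ⟨[S.face (k + 1) x, S.face k l], ?_, ?_, rfl, rfl, rfl, ?_⟩
    · rw [← hx']
      simpa using S.symm (S.adj (by omega) (hlmem k) (hlmem (k + 1)))
    · have : S.face (k + 1) x ≠ S.face k l := fun h => by
        have := congrArg S.level h
        rw [S.level_face (by omega) hxv, S.level_face (by omega) (hlmem k)] at this
        omega
      simpa using this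
    · intro F hF
      simp only [List.mem_cons, List.not_mem_nil, or_false] at hF
      rcases hF with rfl | rfl
      · exact Or.inl ⟨x, le_rfl, hxv, rfl⟩
      · exact Or.inr (Or.inr rfl)
  | succ m ih =>
    intro x hx hxv hm
    -- `v` is the last vertex before `x`
    have hne : ((S.vert (k + 1)).filter fun v => v < x).Nonempty := by
      rw [← Finset.card_pos]; omega
    obtain ⟨v, hv, hvmax⟩ := Finset.exists_max_image _ (fun v : ℝ => v) hne
    simp only [Finset.mem_filter, and_imp] at hv hvmax
    obtain ⟨hvV, hvx⟩ := hv
    set W : Finset ℝ := insert l (S.vert k ∪ S.vert (k + 1) ∪ S.vert (k + 2)) with hW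
    obtain ⟨x₁, hx₁, hW₁⟩ := W.exists_lt_forall_lt v
    obtain ⟨x₂, hx₂, hW₂⟩ := (insert x W).exists_gt_forall_gt v
    have hx₂x : x₂ < x := hW₂ x (by simp) hvx
    have hlx₁ : l < x₁ := hW₁ l (by simp [hW]) (hl _ _ hvV)
    have hsub : ∀ j, j = k ∨ j = k + 1 ∨ j = k + 2 → ∀ u ∈ S.vert j, u ∈ W := by
      rintro j (rfl | rfl | rfl) u hu <;> simp [hW, hu]
    have hx₁V : ∀ j, j = k ∨ j = k + 1 ∨ j = k + 2 → x₁ ∉ S.vert j := fun j hj h =>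
      lt_irrefl _ (hW₁ x₁ (hsub j hj _ h) hx₁)
    have hx₂V : ∀ j, j = k ∨ j = k + 1 ∨ j = k + 2 → x₂ ∉ S.vert j := fun j hj h =>
      lt_irrefl _ (hW₂ x₂ (Finset.mem_insert_of_mem (hsub j hj _ h)) hx₂)
    have hcard : ((S.vert (k + 1)).filter fun v => v < x₁).card = m := by
      have : (S.vert (k + 1)).filter (fun v => v < x₁) =
          ((S.vert (k + 1)).filter fun v => v < x).erase v := by
        ext u
        simp only [Finset.mem_filter, Finset.mem_erase]
        constructor
        · rintro ⟨hu, hux⟩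
          exact ⟨(hux.trans hx₁).ne, hu, hux.trans (hx₁.trans hvx)⟩
        · rintro ⟨huv, hu, hux⟩
          exact ⟨hu, hW₁ u (hsub _ (by simp) u hu) (lt_of_le_of_ne (hvmax u hu hux) huv)⟩
      rw [this, Finset.card_erase_of_mem (Finset.mem_filter.2 ⟨hvV, hvx⟩), hm]
      rfl
    obtain ⟨P, hchain, hnodup, hlen, hhead, hlast, hmem⟩ := ih x₁ hlx₁.le (hx₁V _ (by simp)) hcard
    have hvk : v ∉ S.vert k := S.not_mem_of_mem_succ hvV
    have hvk2 : v ∉ S.vert (k + 2) := S.not_mem_succ hvV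
    have hMx : S.face (k + 1) x₂ = S.face (k + 1) x := by
      refine S.face_eq (by omega) hx₂x.le fun u hu hu' => ?_
      by_contra hlt
      have hux : u < x := lt_of_le_of_ne (not_lt.1 hlt) fun h => hxv (h ▸ hu)
      have := hvmax u hu hux
      linarith
    -- the faces above and below `v`
    have hleft : ∀ j, j = k ∨ j = k + 2 → S.face j x₁ = S.face j v := fun j hj =>
      S.face_eq (by omega) hx₁.le fun u hu hu' => by
        by_contra hlt
        have huv : u < v := lt_of_le_of_ne (not_lt.1 hlt)
          (by rintro rfl; rcases hj with rfl | rfl <;> contradiction)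
        have := hW₁ u (hsub j (by tauto) u hu) huv
        linarith
    have hright : ∀ j, j = k ∨ j = k + 2 → S.face j v = S.face j x₂ := fun j hj =>
      S.face_eq (by omega) (le_of_lt hx₂) fun u hu hu' => by
        have huv : v < u := lt_of_le_of_ne hu'
          (by rintro rfl; rcases hj with rfl | rfl <;> contradiction)
        exact hW₂ u (Finset.mem_insert_of_mem (hsub j (by tauto) u hu)) huv
    have hadj₁ : ∀ j, j = k ∨ j = k + 2 → R (S.face j v) (S.face (k + 1) x₁) := by
      intro j hj
      rw [← hleft j hj]
      rcases hj with rfl | rfl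
      · exact S.adj (by omega) (hx₁V _ (by simp)) (hx₁V _ (by simp))
      · exact S.symm (S.adj (by omega) (hx₁V _ (by simp)) (hx₁V _ (by simp)))
    have hadj₂ : ∀ j, j = k ∨ j = k + 2 → R (S.face (k + 1) x) (S.face j v) := by
      intro j hj
      rw [hright j hj, ← hMx]
      rcases hj with rfl | rfl
      · exact S.symm (S.adj (by omega) (hx₂V _ (by simp)) (hx₂V _ (by simp)))
      · exact S.adj (by omega) (hx₂V _ (by simp)) (hx₂V _ (by simp))
    have hlevx : S.level (S.face (k + 1) x) = k + 1 := S.level_face (by omega) hxv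
    have hlevv : ∀ j, j = k ∨ j = k + 2 → S.level (S.face j v) = j := by
      rintro j (rfl | rfl)
      · exact S.level_face (by omega) hvk
      · exact S.level_face (by omega) hvk2
    -- one of these two faces is new
    obtain ⟨j, hj, hfresh⟩ : ∃ j, (j = k ∨ j = k + 2) ∧ S.face j v ∉ P := by
      have hM : ∀ j, j = k ∨ j = k + 2 → ∀ y, y ∉ S.vert (k + 1) →
          S.face j v ≠ S.face (k + 1) y := by
        intro j hj y hy h
        have := congrArg S.level h
        rw [hlevv j hj, S.level_face (by omega) hy] at this
        omega
      have hcross : ∀ w, w ∉ S.vert k → S.face (k + 2) v ≠ S.face k w := by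
        intro w hw h
        have := congrArg S.level h
        rw [hlevv _ (by simp), S.level_face (by omega) hw] at this
        omega
      by_cases hw : ∃ w ∈ S.vert (k + 1), w < v
      · obtain ⟨w₀, hw₀, hw₀max⟩ := Finset.exists_max_image
          ((S.vert (k + 1)).filter fun w => w < v) (fun w : ℝ => w)
          (by obtain ⟨w, hw, hwv⟩ := hw; exact ⟨w, Finset.mem_filter.2 ⟨hw, hwv⟩⟩)
        simp only [Finset.mem_filter, and_imp] at hw₀ hw₀max
        obtain ⟨u, hu₁, hu₂, hu | hu⟩ := S.between hw₀.1 hvV hw₀.2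
        · refine ⟨k, by simp, fun hF => ?_⟩
          rcases hmem _ hF with ⟨y, -, hy, h⟩ | ⟨w, hw, hwx, h | h⟩ | h
          · exact hM k (by simp) y hy h
          · have := congrArg S.level h
            rw [hlevv _ (by simp), S.level_face (by omega) (S.not_mem_succ hw)] at this
            omega
          · exact S.face_ne (by omega) ((hw₀max w hw (hwx.trans hx₁)).trans_lt hu₁) hu₂ hu
              (S.not_mem_of_mem_succ hw) hvk h.symm
          · exact S.face_ne (by omega) (hl _ u hu) hu₂ hu (hlmem k) hvk h.symm
        · refine ⟨k + 2, by simp, fun hF => ?_⟩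
          rcases hmem _ hF with ⟨y, -, hy, h⟩ | ⟨w, hw, hwx, h | h⟩ | h
          · exact hM (k + 2) (by simp) y hy h
          · exact S.face_ne (by omega) ((hw₀max w hw (hwx.trans hx₁)).trans_lt hu₁) hu₂ hu
              (S.not_mem_succ hw) hvk2 h.symm
          · exact hcross w (S.not_mem_of_mem_succ hw) h
          · exact hcross l (hlmem k) h
      · refine ⟨k + 2, by simp, fun hF => ?_⟩
        rcases hmem _ hF with ⟨y, -, hy, h⟩ | ⟨w, hw', hwx, -⟩ | h
        · exact hM (k + 2) (by simp) y hy h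
        · exact hw ⟨w, hw', hwx.trans hx₁⟩
        · exact hcross l (hlmem k) h
    have hxfresh : S.face (k + 1) x ∉ P := by
      intro hF
      rcases hmem _ hF with ⟨y, hyx, hy, h⟩ | ⟨w, hw, hwx, h | h⟩ | h
      · exact S.face_ne (by omega) (hyx.trans_lt hx₁) hvx hvV hy hxv h.symm
      · have := congrArg S.level h
        rw [hlevx, S.level_face (by omega) (S.not_mem_succ hw)] at this
        omega
      · have := congrArg S.level h
        rw [hlevx, S.level_face (by omega) (S.not_mem_of_mem_succ hw)] at this
        omega
      · have := congrArg S.level h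
        rw [hlevx, S.level_face (by omega) (hlmem k)] at this
        omega
    obtain ⟨G, P', rfl⟩ : ∃ G P', P = G :: P' := by
      cases P with
      | nil => simp at hhead
      | cons G P' => exact ⟨G, P', rfl⟩
    obtain rfl : G = S.face (k + 1) x₁ := by simpa using hhead
    refine ⟨S.face (k + 1) x :: S.face j v :: S.face (k + 1) x₁ :: P', ?_, ?_, ?_, rfl, ?_, ?_⟩
    · exact List.isChain_cons_cons.2 ⟨hadj₂ j hj, List.isChain_cons_cons.2 ⟨hadj₁ j hj, hchain⟩⟩
    · refine List.nodup_cons.2 ⟨?_, List.nodup_cons.2 ⟨hfresh, hnodup⟩⟩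
      rw [List.mem_cons, not_or]
      refine ⟨fun h => ?_, hxfresh⟩
      have := congrArg S.level h
      rw [hlevx, hlevv j hj] at this
      omega
    · simp only [List.length_cons] at hlen ⊢
      omega
    · rw [List.getLast?_cons_cons, List.getLast?_cons_cons]
      exact hlast
    · intro F hF
      rcases List.mem_cons.1 hF with rfl | hF
      · exact Or.inl ⟨x, le_rfl, hxv, rfl⟩
      rcases List.mem_cons.1 hF with rfl | hF
      · refine Or.inr (Or.inl ⟨v, hvV, hvx, ?_⟩)
        rcases hj with rfl | rfl
        · exact Or.inr rfl
        · exact Or.inl rfl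
      rcases hmem F hF with ⟨y, hyx, hy, h⟩ | ⟨w, hw, hwx, h⟩ | h
      · exact Or.inl ⟨y, hyx.trans (hx₁.trans hvx).le, hy, h⟩
      · exact Or.inr (Or.inl ⟨w, hw, hwx.trans (hx₁.trans hvx), h⟩)
      · exact Or.inr (Or.inr h)

/-- A dual path through the levels `k`, `k + 1`, `k + 2` that enters from below at the left end and
leaves at the upper right end, listed backwards. It follows level `k + 1` as long as the face above
is not yet the unbounded one, and then leaves through that face. -/
theorem exists_path_across (k : ℕ) (hk : k + 2 ≤ n) {l r : ℝ} (hlr : l < r)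
    (hl : ∀ j, ∀ v ∈ S.vert j, l < v) (hr : ∀ j, ∀ v ∈ S.vert j, v < r) :
    ∃ P : List Φ, P.IsChain R ∧ P.Nodup ∧
      3 + 2 * (S.vert (k + 1)).card ≤ P.length +
        2 * ((S.vert (k + 1)).rightOf (S.vert (k + 2))).card ∧
      P.head? = some (S.face (k + 2) r) ∧ P.getLast? = some (S.face k l) ∧
      ∀ F ∈ P, k ≤ S.level F ∧ S.level F ≤ k + 2 := by
  have hlmem : ∀ j, l ∉ S.vert j := fun j h => lt_irrefl _ (hl j l h)
  have hrmem : ∀ j, r ∉ S.vert j := fun j h => lt_irrefl _ (hr j r h)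
  set T := (S.vert (k + 1)).rightOf (S.vert (k + 2)) with hT
  obtain ⟨x, hlx, hx1, hx2, hxT, hxU⟩ : ∃ x, l ≤ x ∧ x ∉ S.vert (k + 1) ∧ x ∉ S.vert (k + 2) ∧
      (∀ v ∈ S.vert (k + 1), v < x ↔ v ∉ T) ∧ S.face (k + 2) x = S.face (k + 2) r := by
    rcases T.eq_empty_or_nonempty with hT0 | hne
    · exact ⟨r, hlr.le, hrmem _, hrmem _, fun v hv => by simp [hT0, hr _ v hv], rfl⟩
    · obtain ⟨v₁, hv₁, hmin⟩ := Finset.exists_min_image T (fun v : ℝ => v) hne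
      obtain ⟨hv₁V, hv₁U⟩ := Finset.mem_rightOf.1 hv₁
      obtain ⟨x, hx, hW⟩ :=
        (insert l (S.vert (k + 1) ∪ S.vert (k + 2))).exists_lt_forall_lt v₁
      have hU : ∀ u ∈ S.vert (k + 2), u < x := fun u hu => hW u (by simp [hu]) (hv₁U u hu)
      refine ⟨x, (hW l (by simp) (hl _ _ hv₁V)).le, fun h => lt_irrefl _ (hW x (by simp [h]) hx),
        fun h => lt_irrefl _ (hU x h), fun v hv => ⟨fun hvx hvT => ?_, fun hvT => ?_⟩, ?_⟩
      · have := hmin v hvT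
        linarith
      · refine hW v (by simp [hv]) ?_
        by_contra hle
        exact hvT (Finset.mem_rightOf.2 ⟨hv, fun u hu => (hv₁U u hu).trans_le (not_lt.1 hle)⟩)
      · exact S.face_eq hk (hx.trans (hr _ _ hv₁V)).le fun u hu hxu =>
          absurd (hU u hu) hxu.not_gt
  obtain ⟨P, hchain, hnodup, hlen, hhead, hlast, hmem⟩ :=
    S.exists_path_along k hk hl _ x hlx hx1 rfl
  have hcard : ((S.vert (k + 1)).filter fun v => v < x).card + T.card
      = (S.vert (k + 1)).card := by
    have h1 : (S.vert (k + 1)).filter (fun v => v < x) = S.vert (k + 1) \ T := by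
      ext v
      simp only [Finset.mem_filter, Finset.mem_sdiff]
      exact and_congr_right fun hv => hxT v hv
    have h2 : T ⊆ S.vert (k + 1) := fun v hv => (Finset.mem_rightOf.1 hv).1
    rw [h1, Finset.card_sdiff_of_subset h2]
    exact Nat.sub_add_cancel (Finset.card_le_card h2)
  have hlevr : S.level (S.face (k + 2) r) = k + 2 := S.level_face hk (hrmem _)
  have hfresh : S.face (k + 2) r ∉ P := by
    intro hF
    rcases hmem _ hF with ⟨y, hyx, hy, h⟩ | ⟨w, hw, hwx, h | h⟩ | h
    · have := congrArg S.level h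
      rw [hlevr, S.level_face (by omega) hy] at this
      omega
    · have hwT := (hxT w hw).1 hwx
      obtain ⟨u, hu, huw⟩ : ∃ u ∈ S.vert (k + 2), w ≤ u := by
        by_contra hcon
        push Not at hcon
        exact hwT (Finset.mem_rightOf.2 ⟨hw, hcon⟩)
      exact S.face_ne hk (lt_of_le_of_ne huw fun h => S.not_mem_succ hw (h ▸ hu)) (hr _ u hu) hu
        (S.not_mem_succ hw) (hrmem _) h.symm
    · have := congrArg S.level h
      rw [hlevr, S.level_face (by omega) (S.not_mem_of_mem_succ hw)] at this
      omega
    · have := congrArg S.level h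
      rw [hlevr, S.level_face (by omega) (hlmem k)] at this
      omega
  obtain ⟨G, P', rfl⟩ : ∃ G P', P = G :: P' := by
    cases P with
    | nil => simp at hhead
    | cons G P' => exact ⟨G, P', rfl⟩
  obtain rfl : G = S.face (k + 1) x := by simpa using hhead
  refine ⟨S.face (k + 2) r :: S.face (k + 1) x :: P', ?_, ?_, ?_, rfl, ?_, ?_⟩
  · refine List.isChain_cons_cons.2 ⟨?_, hchain⟩
    rw [← hxU]
    exact S.symm (S.adj (by omega) hx1 hx2)
  · exact List.nodup_cons.2 ⟨hfresh, hnodup⟩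
  · rw [List.length_cons, hlen]
    omega
  · rw [List.getLast?_cons_cons]
    exact hlast
  · intro F hF
    rcases List.mem_cons.1 hF with rfl | hF
    · omega
    rcases hmem F hF with ⟨y, -, hy, rfl⟩ | ⟨w, hw, -, rfl | rfl⟩ | rfl
    · rw [S.level_face (by omega) hy]; omega
    · rw [S.level_face (by omega) (S.not_mem_succ hw)]; omega
    · rw [S.level_face (by omega) (S.not_mem_of_mem_succ hw)]; omega
    · rw [S.level_face (by omega) (hlmem k)]; omega

/-- The unbounded face of level `k` at the right (`s = true`) or left (`s = false`) end, where all
the vertices have abscissas between `-r` and `r`. -/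
def outer (r : ℝ) (s : Bool) (k : ℕ) : Φ := S.face k (if s then r else -r)

/-- The number of vertices of level `k` that lie, at the right or the left end, beyond all the
vertices of level `k + 1`. -/
noncomputable def loss (k : ℕ) : ℕ :=
  ((S.vert k).rightOf (S.vert (k + 1))).card +
    ((S.vert k).leftOf (S.vert (k + 1))).card

theorem outer_not_mem {r : ℝ} (hr : ∀ j, ∀ v ∈ S.vert j, -r < v ∧ v < r) (s : Bool) (j : ℕ) :
    (if s then r else -r) ∉ S.vert j := by
  intro h
  cases s
  · exact lt_irrefl (-r) (hr j _ h).1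
  · exact lt_irrefl r (hr j _ h).2

/-- A dual path through the levels `k`, `k + 1`, `k + 2` with prescribed ends (listed backwards),
which is long if the ends are on different sides. -/
theorem exists_band (k : ℕ) (hk : k + 2 ≤ n) {r : ℝ} (hr0 : 0 < r)
    (hr : ∀ j, ∀ v ∈ S.vert j, -r < v ∧ v < r) (s t : Bool) :
    ∃ P : List Φ, P.IsChain R ∧ P.Nodup ∧
      (if s = t then 0 else 2 * (S.vert (k + 1)).card) ≤ P.length + 2 * S.loss (k + 1) ∧
      P.head? = some (S.outer r t (k + 2)) ∧ P.getLast? = some (S.outer r s k) ∧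
      ∀ F ∈ P, k ≤ S.level F ∧ S.level F ≤ k + 2 := by
  by_cases hst : s = t
  · subst hst
    have hmem := S.outer_not_mem hr s
    have hlev : ∀ j ≤ n, S.level (S.outer r s j) = j := fun j hj => S.level_face hj (hmem j)
    refine ⟨[S.outer r s (k + 2), S.outer r s (k + 1), S.outer r s k], ?_, ?_, by simp, rfl, rfl,
      ?_⟩
    · have h1 := S.symm (S.adj (k := k) (by omega) (hmem k) (hmem (k + 1)))
      have h2 := S.symm (S.adj (k := k + 1) (by omega) (hmem (k + 1)) (hmem (k + 2)))
      simpa [outer] using ⟨h2, h1⟩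
    · refine List.Nodup.of_map S.level ?_
      simp [hlev k (by omega), hlev (k + 1) (by omega), hlev (k + 2) hk]
    · intro F hF
      simp only [List.mem_cons, List.not_mem_nil, or_false] at hF
      rcases hF with rfl | rfl | rfl
      · rw [hlev _ hk]; omega
      · rw [hlev _ (by omega)]; omega
      · rw [hlev _ (by omega)]; omega
  · cases s <;> cases t
    · exact absurd rfl hst
    · obtain ⟨P, h1, h2, h3, h4, h5, h6⟩ := S.exists_path_across k hk (by linarith : -r < r)
        (fun j v hv => (hr j v hv).1) (fun j v hv => (hr j v hv).2)
      refine ⟨P, h1, h2, ?_, by simpa [outer] using h4, by simpa [outer] using h5, h6⟩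
      rw [if_neg hst, loss]
      have : k + 1 + 1 = k + 2 := rfl
      rw [this]
      omega
    · obtain ⟨P, h1, h2, h3, h4, h5, h6⟩ := S.mirror.exists_path_across k hk (by linarith : -r < r)
        (fun j v hv => by
          obtain ⟨v, hv', rfl⟩ := Finset.mem_image.1 hv
          have := hr j v hv'; linarith)
        (fun j v hv => by
          obtain ⟨v, hv', rfl⟩ := Finset.mem_image.1 hv
          have := hr j v hv'; linarith)
      refine ⟨P, h1, h2, ?_, by simpa [outer, mirror] using h4, by simpa [outer, mirror] using h5, h6⟩
      have hc : (S.mirror.vert (k + 1)).card = (S.vert (k + 1)).card :=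
        Finset.card_image_of_injective _ neg_injective
      have hf : ((S.mirror.vert (k + 1)).rightOf (S.mirror.vert (k + 2))).card ≤
          ((S.vert (k + 1)).leftOf (S.vert (k + 2))).card := by
        refine Finset.card_le_card_of_injOn (fun x => -x) (fun v hv => ?_) neg_injective.injOn
        rw [Finset.mem_coe, Finset.mem_rightOf] at hv
        rw [Finset.mem_coe, Finset.mem_leftOf]
        obtain ⟨hv, hv'⟩ := hv
        obtain ⟨v, hv₀, rfl⟩ := Finset.mem_image.1 hv
        refine ⟨by simpa using hv₀, fun u hu => ?_⟩
        have := hv' (-u) (Finset.mem_image_of_mem _ hu)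
        linarith
      rw [if_neg hst, loss]
      have : k + 1 + 1 = k + 2 := rfl
      rw [this]
      omega
    · exact absurd rfl hst

/-- The bands `k₀ + 3 * i, …, k₀ + 3 * i + 2` for `i < m` are traversed one after the other; `s i` is
the side on which the path enters the `i`-th band. -/
theorem exists_snake (k₀ m : ℕ) (hm : k₀ + 3 * m ≤ n + 1) {r : ℝ} (hr0 : 0 < r)
    (hr : ∀ j, ∀ v ∈ S.vert j, -r < v ∧ v < r) (s : ℕ → Bool) :
    ∃ P : List Φ, P.IsChain R ∧ P.Nodup ∧
      (∑ i ∈ Finset.range m, if s i = s (i + 1) then 0 else 2 * (S.vert (k₀ + 3 * i + 1)).card) ≤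
        P.length + 2 * ∑ i ∈ Finset.range m, S.loss (k₀ + 3 * i + 1) ∧
      (∀ F ∈ P, S.level F < k₀ + 3 * m) ∧
      (m = 0 → P = []) ∧ (0 < m → P.head? = some (S.outer r (s m) (k₀ + 3 * m - 1))) ∧
      ∀ i < m, (P.filter fun F => decide (S.level F < k₀ + 3 * (i + 1))).head? =
        some (S.outer r (s (i + 1)) (k₀ + 3 * i + 2)) := by
  induction m with
  | zero => exact ⟨[], by simp⟩
  | succ m ih =>
    obtain ⟨P, hchain, hnodup, hlen, hlev, hnil, hhead, hfil⟩ := ih (by omega)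
    obtain ⟨Q, qchain, qnodup, qlen, qhead, qlast, qlev⟩ :=
      S.exists_band (k₀ + 3 * m) (by omega) hr0 hr (s m) (s (m + 1))
    have hmem := S.outer_not_mem hr (s m)
    refine ⟨Q ++ P, ?_, ?_, ?_, ?_, fun h => absurd h (Nat.succ_ne_zero m), ?_, ?_⟩
    · refine List.isChain_append.2 ⟨qchain, hchain, ?_⟩
      intro F hF G hG
      rw [qlast] at hF
      rcases Nat.eq_zero_or_pos m with rfl | hmpos
      · rw [hnil rfl] at hG
        simp at hG
      · rw [hhead hmpos] at hG
        simp only [Option.mem_def, Option.some.injEq] at hF hG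
        subst hF hG
        obtain ⟨j, hj⟩ : ∃ j, k₀ + 3 * m = j + 1 := ⟨k₀ + 3 * m - 1, by omega⟩
        rw [hj]
        exact S.symm (S.adj (by omega) (hmem j) (hmem (j + 1)))
    · refine List.nodup_append'.2 ⟨qnodup, hnodup, ?_⟩
      intro F hF hF'
      have := qlev F hF
      have := hlev F hF'
      omega
    · rw [Finset.sum_range_succ, Finset.sum_range_succ, List.length_append]
      omega
    · intro F hF
      rcases List.mem_append.1 hF with hF | hF
      · have := qlev F hF; omega
      · have := hlev F hF; omega
    · intro _
      rw [List.head?_append, qhead]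
      rfl
    · intro i hi
      rw [List.filter_append]
      rcases Nat.lt_succ_iff_lt_or_eq.1 hi with hi | rfl
      · have : Q.filter (fun F => decide (S.level F < k₀ + 3 * (i + 1))) = [] := by
          rw [List.filter_eq_nil_iff]
          intro F hF
          have := qlev F hF
          simp only [decide_eq_true_eq]
          omega
        rw [this, List.nil_append]
        exact hfil i hi
      · have : Q.filter (fun F => decide (S.level F < k₀ + 3 * (i + 1))) = Q := by
          rw [List.filter_eq_self]
          intro F hF
          have := qlev F hF
          simp only [decide_eq_true_eq]
          omega
        rw [this, List.head?_append, qhead]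
        rfl

end Layers

/-! ### Long dual paths in simple arrangements -/

theorem Finset.sum_range_comp_le (f : ℕ → ℕ) {g : ℕ → ℕ} (hg : Function.Injective g) {m N : ℕ}
    (hN : ∀ i < m, g i < N) : ∑ i ∈ Finset.range m, f (g i) ≤ ∑ k ∈ Finset.range N, f k := by
  rw [← Finset.sum_image (f := f) hg.injOn]
  refine Finset.sum_le_sum_of_subset fun k hk => ?_
  obtain ⟨i, hi, rfl⟩ := Finset.mem_image.1 hk
  exact Finset.mem_range.2 (hN i (Finset.mem_range.1 hi))

theorem Finset.sum_range_mul_eq (f : ℕ → ℕ) (q N : ℕ) : ∑ k ∈ Finset.range (q * N), f k =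
    ∑ r ∈ Finset.range q, ∑ i ∈ Finset.range N, f (q * i + r) := by
  induction N with
  | zero => simp
  | succ N ih =>
    rw [Nat.mul_succ, Finset.sum_range_add, ih, ← Finset.sum_add_distrib]
    exact Finset.sum_congr rfl fun r _ => (Finset.sum_range_succ _ _).symm

/-- Some residue class modulo `q` carries at least the average weight. -/
theorem Finset.exists_residue_le (f : ℕ → ℕ) {q : ℕ} (hq : 0 < q) (N : ℕ) :
    ∃ r < q, ∑ k ∈ Finset.range (q * N), f k ≤ q * ∑ i ∈ Finset.range N, f (q * i + r) := by
  have h : ∑ r ∈ Finset.range q, ∑ k ∈ Finset.range (q * N), f k ≤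
      ∑ r ∈ Finset.range q, q * ∑ i ∈ Finset.range N, f (q * i + r) := by
    rw [← Finset.mul_sum, ← Finset.sum_range_mul_eq, Finset.sum_const, Finset.card_range,
      smul_eq_mul]
  obtain ⟨r, hr, h⟩ := Finset.exists_le_of_sum_le (Finset.nonempty_range_iff.2 hq.ne') h
  exact ⟨r, Finset.mem_range.1 hr, h⟩

namespace PseudolineArrangement

variable {n : ℕ} {A : PseudolineArrangement n}

theorem card_pairs (n : ℕ) : 2 * (pairs n).card + n = n * n := by
  have h1 : (Finset.univ : Finset (Fin n)).offDiag = pairs n ∪ (pairs n).image Prod.swap := by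
    ext ⟨i, j⟩
    simp only [Finset.mem_offDiag, Finset.mem_univ, true_and, pairs, Finset.mem_union,
      Finset.mem_filter, Finset.mem_image, Prod.exists, Prod.swap_prod_mk, Prod.mk.injEq]
    constructor
    · intro h
      rcases lt_or_gt_of_ne h with h | h
      · exact Or.inl h
      · exact Or.inr ⟨j, i, h, rfl, rfl⟩
    · rintro (h | ⟨a, b, h, rfl, rfl⟩)
      · exact h.ne
      · exact h.ne'
  have h2 : Disjoint (pairs n) ((pairs n).image Prod.swap) := by
    rw [Finset.disjoint_left]
    rintro ⟨i, j⟩ h h'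
    simp only [pairs, Finset.mem_filter, Finset.mem_univ, true_and, Finset.mem_image, Prod.exists,
      Prod.swap_prod_mk, Prod.mk.injEq] at h h'
    obtain ⟨a, b, hab, rfl, rfl⟩ := h'
    exact lt_asymm h hab
  have h3 := congrArg Finset.card h1
  rw [Finset.offDiag_card, Finset.card_union_of_disjoint h2,
    Finset.card_image_of_injective _ Prod.swap_injective, Finset.card_univ, Fintype.card_fin] at h3
  have : n ≤ n * n := Nat.le_mul_self n
  omega

/-- The faces of a simple arrangement, arranged by levels. -/
noncomputable def layers (hA : A.IsSimple) : Layers A.Face A.dualGraph.Adj n where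
  vert := A.vertices
  face := A.face
  level := A.level
  symm h := h.symm
  level_face hk hx := level_face ((mem_gap_iff hA hk).2 hx)
  face_eq hk hxy h := face_eq_of_Icc_subset hxy fun _ hu =>
    (mem_gap_iff hA hk).2 fun hv => (h _ hv hu.1).not_ge hu.2
  face_ne hk hxv hvy hv hx _ := face_ne_of_not_mem_gap hxv.le hvy.le ((mem_gap_iff hA hk).2 hx)
    (not_mem_gap_of_mem_vertices hv)
  adj hk hx hx' := adj_face ((mem_gap_iff hA (by omega)).2 hx) ((mem_gap_iff hA hk).2 hx')
  not_mem_succ := not_mem_vertices_succ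
  between := exists_vertex_between hA

theorem exists_bound_vertices (A : PseudolineArrangement n) :
    ∃ r : ℝ, 0 < r ∧ ∀ j, ∀ v ∈ A.vertices j, -r < v ∧ v < r := by
  obtain ⟨r, hr⟩ := (Finset.finite_toSet
    (((Finset.range n).biUnion A.vertices).image fun v => |v|)).bddAbove
  refine ⟨max r 0 + 1, by positivity, fun j v hv => ?_⟩
  have hj : j < n := by
    have := (one_le_of_mem_vertices hv).2
    omega
  have := hr (Finset.mem_coe.2 (Finset.mem_image_of_mem (fun v => |v|)
    (Finset.mem_biUnion.2 ⟨j, Finset.mem_range.2 hj, hv⟩)))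
  rw [← abs_lt]
  have := le_max_left r 0
  linarith

theorem card_pairs_le (hA : A.IsSimple) {N : ℕ} (hN : n ≤ N) :
    (pairs n).card ≤ ∑ k ∈ Finset.range N, (A.vertices (k + 1)).card := by
  rw [← sum_card_vertices hA]
  have h0 : (A.vertices 0).card = 0 := by
    rw [Finset.card_eq_zero]
    refine Finset.eq_empty_of_forall_notMem fun v hv => ?_
    have := (one_le_of_mem_vertices hv).1
    omega
  have h : ∑ k ∈ Finset.range (N + 1), (A.vertices k).card
      = ∑ k ∈ Finset.range N, (A.vertices (k + 1)).card := by
    rw [Finset.sum_range_succ', h0, add_zero]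
  rw [← h]
  exact Finset.sum_le_sum_of_subset (Finset.range_subset_range.2 (by omega))

theorem sum_loss_le (hA : A.IsSimple) (k₀ m : ℕ) :
    ∑ i ∈ Finset.range m, (layers hA).loss (k₀ + 3 * i + 1) ≤ 2 * n := by
  refine (Finset.sum_range_comp_le (layers hA).loss (g := fun i => k₀ + 3 * i + 1)
    (fun i j h => by simp only at h; omega) (N := k₀ + 3 * m + 1)
    (fun i hi => by omega)).trans ?_
  have h1 := sum_card_rightmost_le hA (k₀ + 3 * m + 1)
  have h2 := sum_card_leftmost_le hA (k₀ + 3 * m + 1)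
  simp only [Layers.loss, Finset.sum_add_distrib]
  have h3 : (layers hA).vert = A.vertices := rfl
  rw [h3]
  omega

/-- Every simple arrangement has a dual path of length at least `n² / 3 - 5 n`. -/
theorem exists_long_dualPath (hA : A.IsSimple) :
    ∃ P : List A.Face, A.IsDualPath P ∧ (n : ℝ) ^ 2 / 3 - 5 * n ≤ (P.length : ℝ) := by
  rcases lt_or_ge n 4 with hn | hn
  · refine ⟨[A.face 0 0], ⟨by simp, by simp, by simp⟩, ?_⟩
    have h : (n : ℝ) ≤ 4 := by exact_mod_cast hn.le
    have h0 : (0 : ℝ) ≤ n := by positivity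
    simp only [List.length_singleton, Nat.cast_one]
    nlinarith
  obtain ⟨k₀, hk₀, hsum⟩ :=
    Finset.exists_residue_le (fun k => (A.vertices (k + 1)).card) (q := 3) (by norm_num) n
  obtain ⟨r, hr0, hr⟩ := A.exists_bound_vertices
  set m := (n + 1 - k₀) / 3 with hm
  obtain ⟨P, h1, h2, h3, -, -, h5, -⟩ := (layers hA).exists_snake k₀ m (by omega) hr0 hr
    (fun i => decide (i % 2 = 0))
  refine ⟨P, ⟨?_, h1, h2⟩, ?_⟩
  · have := h5 (by omega)
    rintro rfl
    simp at this
  have hpairs := (card_pairs_le hA (by omega : n ≤ 3 * n)).trans hsum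
  have hcp := card_pairs n
  have hloss := sum_loss_le hA k₀ m
  have hle : 2 * ∑ i ∈ Finset.range n, (A.vertices (3 * i + k₀ + 1)).card ≤
      ∑ i ∈ Finset.range m, if decide (i % 2 = 0) = decide ((i + 1) % 2 = 0) then 0 else
        2 * ((layers hA).vert (k₀ + 3 * i + 1)).card := by
    rw [← Finset.sum_subset (Finset.range_subset_range.2 (by omega : m ≤ n)), Finset.mul_sum]
    · refine Finset.sum_le_sum fun i _ => ?_
      rw [if_neg, add_comm (3 * i) k₀]
      · rfl
      · rw [decide_eq_decide]
        omega
    · intro i _ hi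
      rw [Finset.mem_range, not_lt] at hi
      rw [vertices_eq_empty (by omega), Finset.card_empty]
  have hfin : n * n ≤ 3 * P.length + 13 * n := by
    omega
  have hfin' : (n : ℝ) * n ≤ 3 * P.length + 13 * n := by exact_mod_cast hfin
  have h0 : (0 : ℝ) ≤ n := by positivity
  nlinarith

/-- Every simple arrangement has at least `(21 / 20) ^ n` dual paths of length at least `n² / 12`,
if `n ≥ 60`. Every other band of the snake is traversed in any case; the side on which the snake enters
these bands, given by a set `u` of numbers, is free. -/
theorem exists_many_dualPaths (hA : A.IsSimple) (hn : 60 ≤ n) :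
    ∃ S : Finset (List A.Face),
      (∀ P ∈ S, A.IsDualPath P ∧ (1 / 12 : ℝ) * (n : ℝ) ^ 2 ≤ (P.length : ℝ)) ∧
        (21 / 20 : ℝ) ^ n ≤ (S.card : ℝ) := by
  classical
  obtain ⟨k₀, hk₀, hsum⟩ :=
    Finset.exists_residue_le (fun k => (A.vertices (k + 1)).card) (q := 6) (by norm_num) n
  obtain ⟨r, hr0, hr⟩ := A.exists_bound_vertices
  set m := (n + 1 - k₀) / 3 with hm
  set M := (m - 1) / 2 with hM
  set s : Finset ℕ → ℕ → Bool := fun u i =>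
    if i % 2 = 0 then decide (i / 2 ∈ u) else !decide (i / 2 ∈ u) with hs
  have hsnake := fun u => (layers hA).exists_snake k₀ m (by omega) hr0 hr (s u)
  choose P hP1 hP2 hP3 hP4 hPnil hP5 hP6 using hsnake
  refine ⟨(Finset.Icc 1 M).powerset.image P, ?_, ?_⟩
  · intro Q hQ
    obtain ⟨u, -, rfl⟩ := Finset.mem_image.1 hQ
    refine ⟨⟨?_, hP1 u, hP2 u⟩, ?_⟩
    · have h5 := hP5 u (by omega)
      intro h
      simp [h] at h5
    have hpairs := (card_pairs_le hA (by omega : n ≤ 6 * n)).trans hsum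
    have hcp := card_pairs n
    have hloss := sum_loss_le hA k₀ m
    have h3 := hP3 u
    have hle : 2 * ∑ i ∈ Finset.range n, (A.vertices (6 * i + k₀ + 1)).card ≤
        ∑ i ∈ Finset.range m, if s u i = s u (i + 1) then 0 else
          2 * ((layers hA).vert (k₀ + 3 * i + 1)).card := by
      refine le_trans ?_ (Finset.sum_range_comp_le (fun i => if s u i = s u (i + 1) then 0 else
          2 * ((layers hA).vert (k₀ + 3 * i + 1)).card) (g := fun i => 2 * i)
          (fun i j h => by simp only at h; omega) (m := (m + 1) / 2)
          (fun i hi => by omega))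
      rw [← Finset.sum_subset (Finset.range_subset_range.2 (by omega : (m + 1) / 2 ≤ n)),
        Finset.mul_sum]
      · refine Finset.sum_le_sum fun i _ => ?_
        rw [if_neg, show k₀ + 3 * (2 * i) + 1 = 6 * i + k₀ + 1 by ring]
        · rfl
        · have h1 : (2 * i) % 2 = 0 := by omega
          have h2 : ¬ (2 * i + 1) % 2 = 0 := by omega
          have h3 : (2 * i + 1) / 2 = 2 * i / 2 := by omega
          simp only [hs, if_pos h1, if_neg h2, h3]
          cases decide (2 * i / 2 ∈ u) <;> simp
      · intro i _ hi
        rw [Finset.mem_range, not_lt] at hi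
        rw [vertices_eq_empty (by omega), Finset.card_empty]
    have hfin : n * n ≤ 6 * (P u).length + 25 * n := by omega
    have hfin' : (n : ℝ) * n ≤ 6 * (P u).length + 25 * n := by exact_mod_cast hfin
    have h0 : (60 : ℝ) ≤ n := by exact_mod_cast hn
    nlinarith
  · have hinj : Set.InjOn P ((Finset.Icc 1 M).powerset : Finset (Finset ℕ)) := by
      intro u hu u' hu' huu
      rw [Finset.mem_coe, Finset.mem_powerset] at hu hu'
      -- the first face of the snake above the band `2 * t - 1` tells whether `t ∈ u`
      have key : ∀ t ∈ Finset.Icc 1 M, (t ∈ u ↔ t ∈ u') := by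
        intro t ht
        rw [Finset.mem_Icc] at ht
        obtain ⟨i, rfl⟩ : ∃ i, t = i + 1 := ⟨t - 1, by omega⟩
        have h1 := hP6 u (2 * i + 1) (by omega)
        have h2 := hP6 u' (2 * i + 1) (by omega)
        rw [huu, h2, Option.some.injEq] at h1
        set j := k₀ + 3 * (2 * i + 1) + 2 with hj
        have hne : (layers hA).outer r false j ≠ (layers hA).outer r true j := by
          obtain ⟨v, hv⟩ := vertices_nonempty hA (by omega : 1 ≤ j) (by omega : j < n)
          exact (layers hA).face_ne (by omega) (hr j v hv).1 (hr j v hv).2 hv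
            ((layers hA).outer_not_mem hr false j) ((layers hA).outer_not_mem hr true j)
        have h3 : s u (2 * i + 1 + 1) = s u' (2 * i + 1 + 1) := by
          revert h1
          cases s u (2 * i + 1 + 1) <;> cases s u' (2 * i + 1 + 1)
          · exact fun _ => rfl
          · exact fun h => absurd h.symm hne
          · exact fun h => absurd h hne
          · exact fun _ => rfl
        have h4 : (2 * i + 1 + 1) % 2 = 0 := by omega
        have h5 : (2 * i + 1 + 1) / 2 = i + 1 := by omega
        simp only [hs, if_pos h4, h5, decide_eq_decide] at h3
        exact h3
      ext t
      exact ⟨fun h => (key t (hu h)).1 h, fun h => (key t (hu' h)).2 h⟩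
    rw [Finset.card_image_of_injOn hinj, Finset.card_powerset, Nat.card_Icc,
      Nat.add_sub_cancel, Nat.cast_pow, Nat.cast_ofNat]
    calc (21 / 20 : ℝ) ^ n ≤ (21 / 20 : ℝ) ^ (12 * M) :=
          pow_le_pow_right₀ (by norm_num) (by omega)
      _ = ((21 / 20 : ℝ) ^ 12) ^ M := pow_mul _ _ _
      _ ≤ 2 ^ M := pow_le_pow_left₀ (by norm_num) (by norm_num) _

end PseudolineArrangement

/-! ### Dual paths alternate between even and odd levels -/

/-- In a list in which each element with property `p` alternates with one without, at most one more
than half of the elements fail to have the property. -/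
theorem List.IsChain.length_le_two_mul_countP {α : Type*} {p : α → Bool} {l : List α}
    (h : l.IsChain fun a b => p a = !p b) : l.length ≤ 2 * l.countP p + 1 := by
  have key : l.length ≤ 2 * l.countP p + 1 ∧
      ∀ a ∈ l.head?, p a = true → l.length ≤ 2 * l.countP p := by
    induction l with
    | nil => simp
    | cons a l ih =>
      obtain ⟨h1, h2⟩ := ih h.tail
      cases ha : p a
      · rw [List.countP_cons_of_neg (by simp [ha])]
        refine ⟨?_, fun b hb hpb => ?_⟩
        · cases l with
          | nil => simp
          | cons b l =>
            have hb := (List.isChain_cons_cons.1 h).1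
            rw [ha] at hb
            have := h2 b rfl (by simpa using hb.symm)
            rw [List.length_cons]
            omega
        · simp only [List.head?_cons, Option.mem_def, Option.some.injEq] at hb
          rw [← hb, ha] at hpb
          exact absurd hpb (by simp)
      · rw [List.countP_cons_of_pos ha, List.length_cons]
        exact ⟨by omega, fun _ _ _ => by omega⟩
  exact key.1

namespace PseudolineArrangement

variable {n : ℕ} {A : PseudolineArrangement n}

/-- A face is determined by its level and the number of vertices of the same level to its left. -/
theorem face_eq_of_card_eq (hA : A.IsSimple) {k : ℕ} {x y : ℝ} (hx : x ∈ A.gap k)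
    (hy : y ∈ A.gap k)
    (h : ((A.vertices k).filter fun v => v < x).card =
      ((A.vertices k).filter fun v => v < y).card) : A.face k x = A.face k y := by
  wlog hxy : x ≤ y generalizing x y
  · exact (this hy hx h.symm (le_of_not_ge hxy)).symm
  have hsub : (A.vertices k).filter (fun v => v < x) ⊆ (A.vertices k).filter fun v => v < y := by
    intro v hv
    rw [Finset.mem_filter] at hv ⊢
    exact ⟨hv.1, hv.2.trans_le hxy⟩
  have heq := Finset.eq_of_subset_of_card_le hsub h.ge
  refine face_eq_of_Icc_subset hxy fun u hu => (mem_gap_iff hA (gap_le hx)).2 fun huV => ?_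
  have huy : u < y := lt_of_le_of_ne hu.2 fun he => not_mem_gap_of_mem_vertices huV (he ▸ hy)
  have hux : u ∈ (A.vertices k).filter fun v => v < x := by
    rw [heq]; exact Finset.mem_filter.2 ⟨huV, huy⟩
  exact (Finset.mem_filter.1 hux).2.not_ge hu.1

/-- The number of faces whose level has a given parity is at most the number of crossings of such
levels, plus one for every level. -/
theorem card_faces_le (hA : A.IsSimple) (e : ℕ) (s : Finset A.Face)
    (hs : ∀ F ∈ s, A.level F % 2 = e) :
    s.card ≤ ((pairs n).filter fun p => A.crossingLevel p % 2 = e).card + (n + 1) := by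
  classical
  choose x hx hFx using fun F : A.Face => exists_eq_face F
  set t := (Finset.range (n + 1)).filter fun k => k % 2 = e with ht
  have h1 : s.card ≤ (t.sigma fun k => Finset.range ((A.vertices k).card + 1)).card := by
    refine Finset.card_le_card_of_injOn (fun F => (⟨A.level F,
      ((A.vertices (A.level F)).filter fun v => v < x F).card⟩ : (_ : ℕ) × ℕ)) ?_ ?_
    · intro F hF
      have := gap_le (hx F)
      simp only [Finset.coe_sigma, Set.mem_sigma_iff, Finset.mem_coe, ht, Finset.mem_filter,
        Finset.mem_range]
      exact ⟨⟨by omega, hs F hF⟩, Nat.lt_succ_of_le (Finset.card_filter_le _ _)⟩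
    · intro F _ G _ hFG
      simp only [Sigma.mk.injEq, heq_eq_eq] at hFG
      have hG := hx G
      rw [← hFG.1] at hG
      have hFG2 := hFG.2
      rw [← hFG.1] at hFG2
      have := face_eq_of_card_eq hA (hx F) hG hFG2
      rw [hFx F, hFx G, this, hFG.1]
  have h2 : ((pairs n).filter fun p => A.crossingLevel p % 2 = e).card =
      ∑ k ∈ t, (A.vertices k).card := by
    rw [Finset.card_eq_sum_card_fiberwise (f := A.crossingLevel) (t := t)]
    · refine Finset.sum_congr rfl fun k hk => ?_
      rw [card_vertices hA, Finset.filter_filter]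
      congr 1
      ext p
      simp only [Finset.mem_filter]
      have := (Finset.mem_filter.1 hk).2
      constructor
      · rintro ⟨h, -, h'⟩; exact ⟨h, h'⟩
      · rintro ⟨h, h'⟩; exact ⟨h, by rw [h']; exact this, h'⟩
    · intro p hp
      rw [Finset.mem_coe, Finset.mem_filter] at hp
      have : A.crossing p ∈ A.vertices (A.crossingLevel p) :=
        Finset.mem_image.2 ⟨p, Finset.mem_filter.2 ⟨hp.1, rfl⟩, rfl⟩
      have := (one_le_of_mem_vertices this).2
      rw [Finset.mem_coe, ht, Finset.mem_filter, Finset.mem_range]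
      exact ⟨by omega, hp.2⟩
  have h3 : t.card ≤ n + 1 := by
    simpa using Finset.card_filter_le (Finset.range (n + 1)) fun k => k % 2 = e
  rw [Finset.card_sigma] at h1
  simp only [Finset.card_range, Finset.sum_add_distrib, Finset.sum_const, smul_eq_mul,
    mul_one] at h1
  omega

/-- A dual path alternates between even and odd levels, so it is short if there are few faces of one
parity. -/
theorem length_dualPath_le (hA : A.IsSimple) (e : ℕ) (he : e < 2) {P : List A.Face}
    (hP : A.IsDualPath P) :
    P.length ≤ 2 * (((pairs n).filter fun p => A.crossingLevel p % 2 = e).card + (n + 1)) + 1 := by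
  classical
  obtain ⟨-, hchain, hnodup⟩ := hP
  have h1 : P.IsChain fun F G =>
      decide (A.level F % 2 = e) = !decide (A.level G % 2 = e) := by
    refine hchain.imp fun F G hFG => ?_
    have := even_level_iff_of_adj hFG
    rw [Nat.even_iff, Nat.even_iff] at this
    rw [← decide_not, decide_eq_decide]
    omega
  have h2 := h1.length_le_two_mul_countP
  have h3 : P.countP (fun F => decide (A.level F % 2 = e)) =
      (P.toFinset.filter fun F => A.level F % 2 = e).card := by
    rw [List.countP_eq_length_filter, ← List.toFinset_card_of_nodup (hnodup.filter _),
      List.toFinset_filter]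
    simp
  have h4 := card_faces_le hA e (P.toFinset.filter fun F => A.level F % 2 = e)
    fun F hF => (Finset.mem_filter.1 hF).2
  omega

end PseudolineArrangement

/-! ### Lines tangent to a deltoid -/

/-- By symmetry, at most a sixth of the `n²` triples of residues modulo `n` with a given sum are
increasing. -/
theorem six_mul_card_strictMono_le (n d : ℕ) :
    6 * ((Finset.univ : Finset (Fin 3 → Fin n)).filter fun h : Fin 3 → Fin n =>
      StrictMono h ∧ n ∣ (∑ i, (h i : ℕ)) + d).card ≤ n * n := by
  classical
  set S := (Finset.univ : Finset (Fin 3 → Fin n)).filter fun h : Fin 3 → Fin n =>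
      StrictMono h ∧ n ∣ (∑ i, (h i : ℕ)) + d with hS
  set Z := (Finset.univ : Finset (Fin 3 → Fin n)).filter fun h : Fin 3 → Fin n =>
      n ∣ (∑ i, (h i : ℕ)) + d with hZ
  have h1 : (S ×ˢ (Finset.univ : Finset (Equiv.Perm (Fin 3)))).card ≤ Z.card := by
    refine Finset.card_le_card_of_injOn (fun p => p.1 ∘ p.2) ?_ ?_
    · rintro ⟨h, σ⟩ hp
      simp only [Finset.mem_coe, Finset.mem_product, hS, hZ, Finset.mem_filter, Finset.mem_univ,
        true_and, and_true, Function.comp_apply] at hp ⊢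
      rw [Equiv.sum_comp σ (fun i => (h i : ℕ))]
      exact hp.2
    · rintro ⟨h, σ⟩ hp ⟨h', σ'⟩ hp' heq
      simp only [Finset.mem_coe, Finset.mem_product, hS, Finset.mem_filter, Finset.mem_univ,
        true_and, and_true] at hp hp' heq
      have hr : Set.range h = Set.range h' := by
        rw [← σ.surjective.range_comp h, heq, σ'.surjective.range_comp h']
      obtain rfl := (hp.1.range_inj hp'.1).1 hr
      have : σ = σ' := Equiv.ext fun i => hp.1.injective (congrFun heq i)
      rw [this]
  have h2 : Z.card ≤ ((Finset.univ : Finset (Fin n)) ×ˢ (Finset.univ : Finset (Fin n))).card := by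
    refine Finset.card_le_card_of_injOn (fun h => (h 0, h 1)) (by simp) ?_
    intro h hh h' hh' heq
    simp only [hZ, Finset.mem_coe, Finset.mem_filter, Finset.mem_univ, true_and,
      Fin.sum_univ_three] at hh hh'
    simp only [Prod.mk.injEq] at heq
    obtain ⟨h0, h1⟩ := heq
    have h2 : h 2 = h' 2 := by
      rw [h0, h1] at hh
      have hmod : (h' 0 + h' 1 + d : ℕ) + (h 2 : ℕ) ≡
          (h' 0 + h' 1 + d : ℕ) + (h' 2 : ℕ) [MOD n] := by
        refine ((Nat.modEq_zero_iff_dvd.2 ?_).trans (Nat.modEq_zero_iff_dvd.2 ?_).symm)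
        · convert hh using 1; ring
        · convert hh' using 1; ring
      have := Nat.ModEq.add_left_cancel' _ hmod
      exact Fin.ext (Nat.ModEq.eq_of_lt_of_lt this (h 2).2 (h' 2).2)
    ext i
    fin_cases i
    · exact congrArg Fin.val h0
    · exact congrArg Fin.val h1
    · exact congrArg Fin.val h2
  rw [Finset.card_product, Finset.card_univ, Fintype.card_perm, Fintype.card_fin] at h1
  rw [Finset.card_product, Finset.card_univ, Fintype.card_fin] at h2
  have : Nat.factorial 3 = 6 := rfl
  rw [this] at h1
  omega

/-- Among `n` consecutive integers starting with `c`, the parity of the number of those in an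
even-numbered block of length `n` is that of `n + c`. -/
theorem sum_even_div_mod_two {n : ℕ} (hn : 0 < n) (c : ℕ) :
    (∑ k ∈ Finset.range n, if Even ((c + k) / n) then 1 else 0) % 2 = (n + c) % 2 := by
  induction c with
  | zero =>
    have : ∀ k ∈ Finset.range n, (if Even ((0 + k) / n) then 1 else 0) = 1 := by
      intro k hk
      rw [zero_add, Nat.div_eq_of_lt (Finset.mem_range.1 hk), if_pos (by simp)]
    rw [Finset.sum_congr rfl this]
    simp
  | succ c ih =>
    have h1 : (∑ k ∈ Finset.range n, if Even ((c + 1 + k) / n) then 1 else 0) +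
        (if Even ((c + 0) / n) then 1 else 0) =
        (∑ k ∈ Finset.range n, if Even ((c + k) / n) then 1 else 0) +
        (if Even ((c + n) / n) then 1 else 0) := by
      rw [← Finset.sum_range_succ (fun k => if Even ((c + k) / n) then 1 else 0),
        Finset.sum_range_succ']
      congr 1
      exact Finset.sum_congr rfl fun k _ => by rw [add_right_comm, add_assoc]
    rw [add_zero, Nat.add_div_right c hn] at h1
    simp only [Nat.even_add_one] at h1
    split_ifs at h1 <;> omega

/-- For the line family `x cos u + y sin u = cos (3 u)`: on the crossing of the lines with
angles `s` and `t`, the position of the line with angle `u` is given by a product. -/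
theorem tangent_identity {s t x y : ℝ} (hst : Real.sin (t - s) ≠ 0)
    (hs : x * Real.cos s + y * Real.sin s = Real.cos (3 * s))
    (ht : x * Real.cos t + y * Real.sin t = Real.cos (3 * t)) (u : ℝ) :
    x * Real.cos u + y * Real.sin u - Real.cos (3 * u) =
      4 * Real.sin (u - s) * Real.sin (u - t) * Real.cos (u + s + t) := by
  have h3 : ∀ z : ℝ, Real.cos (3 * z) = Real.cos z ^ 3 - 3 * Real.cos z * Real.sin z ^ 2 := by
    intro z
    rw [Real.cos_three_mul]
    linear_combination (3 * Real.cos z) * Real.sin_sq_add_cos_sq z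
  have hmain : Real.sin (t - u) * Real.cos (3 * s) + Real.sin (u - s) * Real.cos (3 * t)
      - Real.sin (t - s) * Real.cos (3 * u) =
      Real.sin (t - s) * (4 * Real.sin (u - s) * Real.sin (u - t) * Real.cos (u + s + t)) := by
    have es := Real.cos_sq_add_sin_sq s
    have et := Real.cos_sq_add_sin_sq t
    have eu := Real.cos_sq_add_sin_sq u
    rw [h3, h3, h3]
    simp only [Real.sin_sub, Real.cos_add, Real.sin_add]
    generalize Real.cos s = a at *
    generalize Real.sin s = b at *
    generalize Real.cos t = c at *
    generalize Real.sin t = e at *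
    generalize Real.cos u = f at *
    generalize Real.sin u = g at *
    -- multiplied by suitable factors `cos² + sin²`, all terms get the same degrees
    have hom : (e * f - c * g) * (a ^ 3 - 3 * a * b ^ 2) * ((c ^ 2 + e ^ 2) * (f ^ 2 + g ^ 2))
        + (g * a - f * b) * (c ^ 3 - 3 * c * e ^ 2) * ((a ^ 2 + b ^ 2) * (f ^ 2 + g ^ 2))
        - (e * a - c * b) * (f ^ 3 - 3 * f * g ^ 2) * ((a ^ 2 + b ^ 2) * (c ^ 2 + e ^ 2)) =
        (e * a - c * b) * (4 * (g * a - f * b) * (g * c - f * e) *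
          ((f * a - g * b) * c - (g * a + f * b) * e)) := by
      ring
    rw [es, et, eu] at hom
    linear_combination hom
  have hlin : Real.sin (t - s) * (x * Real.cos u + y * Real.sin u) =
      Real.sin (t - u) * Real.cos (3 * s) + Real.sin (u - s) * Real.cos (3 * t) := by
    rw [← hs, ← ht, Real.sin_sub, Real.sin_sub, Real.sin_sub]
    ring
  apply mul_left_cancel₀ hst
  linear_combination hlin + hmain

/-- Two lines of different slopes cross exactly once. -/
theorem crossExactlyOnce_lines {a b a' b' : ℝ} (h : a ≠ a') :
    CrossExactlyOnce (fun x => a * x + b) (fun x => a' * x + b') := by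
  have hne : a - a' ≠ 0 := sub_ne_zero.2 h
  have key : ∀ x, (a * x + b) - (a' * x + b') = (a - a') * (x - (b' - b) / (a - a')) := by
    intro x
    field_simp
    ring
  refine ⟨(b' - b) / (a - a'), ?_, ?_⟩
  · have := key ((b' - b) / (a - a'))
    rw [sub_self, mul_zero] at this
    exact sub_eq_zero.1 this
  · rcases lt_or_gt_of_ne h with h | h
    · right
      constructor <;> intro x hx <;> have := key x
      · have : 0 < (a - a') * (x - (b' - b) / (a - a')) :=
          mul_pos_of_neg_of_neg (by linarith) (by linarith)
        simp only; linarith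
      · have : (a - a') * (x - (b' - b) / (a - a')) < 0 :=
          mul_neg_of_neg_of_pos (by linarith) (by linarith)
        simp only; linarith
    · left
      constructor <;> intro x hx <;> have := key x
      · have : (a - a') * (x - (b' - b) / (a - a')) < 0 :=
          mul_neg_of_pos_of_neg (by linarith) (by linarith)
        simp only; linarith
      · have : 0 < (a - a') * (x - (b' - b) / (a - a')) :=
          mul_pos (by linarith) (by linarith)
        simp only; linarith

namespace PseudolineArrangement

/-- The summand `(n + 1) / 2`, rounded down, that turns the sum of the indices of three lines into the
position of the sum of their angles. -/
def shift (n : ℕ) : ℕ := (n + 1) / 2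

/-- The equidistant angles of the lines, `π (k + δ) / n` with `3 δ + n / 2 = shift n + 1 / 2`, so that
`δ` is `1 / 6` or `1 / 3`. -/
noncomputable def angle (n k : ℕ) : ℝ :=
  Real.pi * (k + (2 * shift n + 1 - n) / 6) / n

theorem shift_cases (n : ℕ) : (n : ℝ) = 2 * shift n ∨ (n : ℝ) + 1 = 2 * shift n := by
  rcases Nat.even_or_odd' n with ⟨m, h | h⟩
  · left
    have : n = 2 * shift n := by unfold shift; omega
    exact_mod_cast this
  · right
    have : n + 1 = 2 * shift n := by unfold shift; omega
    exact_mod_cast this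

theorem angle_mem {n k : ℕ} (hk : k < n) : 0 < angle n k ∧ angle n k < Real.pi := by
  have hn : (0 : ℝ) < n := by exact_mod_cast (by omega : 0 < n)
  have hk' : (k : ℝ) + 1 ≤ n := by exact_mod_cast hk
  have hk0 : (0 : ℝ) ≤ k := by positivity
  have hpi := Real.pi_pos
  unfold angle
  constructor
  · apply div_pos _ hn
    apply mul_pos hpi
    rcases shift_cases n with h | h <;> linarith
  · rw [div_lt_iff₀ hn]
    apply mul_lt_mul_of_pos_left _ hpi
    rcases shift_cases n with h | h <;> linarith

theorem angle_lt {n k l : ℕ} (hn : 0 < n) (h : k < l) : angle n k < angle n l := by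
  have hn : (0 : ℝ) < n := by exact_mod_cast hn
  unfold angle
  apply div_lt_div_of_pos_right _ hn
  apply mul_lt_mul_of_pos_left _ Real.pi_pos
  have : (k : ℝ) < l := by exact_mod_cast h
  linarith

theorem sin_angle_sub_pos {n k l : ℕ} (hl : l < n) (h : k < l) :
    0 < Real.sin (angle n l - angle n k) := by
  have h1 := angle_mem hl
  have h2 := angle_mem (h.trans hl)
  have h3 := angle_lt (by omega : 0 < n) h
  exact Real.sin_pos_of_pos_of_lt_pi (by linarith) (by linarith)

theorem sin_angle_sub_neg {n k l : ℕ} (hl : l < n) (h : k < l) :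
    Real.sin (angle n k - angle n l) < 0 := by
  rw [← neg_sub, Real.sin_neg]
  exact neg_neg_of_pos (sin_angle_sub_pos hl h)

/-- The sign of `cos (u + s + t)` is given by the block of length `n` to which the sum of the indices
belongs. It is never zero, due to the summand `1 / 2` in the shift of the angles. -/
theorem cos_angle_add {n : ℕ} (hn : 0 < n) (i j k : ℕ) :
    ∃ c : ℝ, 0 < c ∧ Real.cos (angle n k + angle n i + angle n j) =
      (-1) ^ ((i + j + shift n + k) / n) * c := by
  set N := i + j + shift n + k with hN
  have hn' : (0 : ℝ) < n := by exact_mod_cast hn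
  refine ⟨Real.sin (Real.pi * ((N % n : ℕ) + 1 / 2) / n), ?_, ?_⟩
  · have hr : ((N % n : ℕ) : ℝ) + 1 ≤ n := by exact_mod_cast Nat.mod_lt N hn
    apply Real.sin_pos_of_pos_of_lt_pi
    · have := Real.pi_pos
      positivity
    · rw [div_lt_iff₀ hn']
      exact mul_lt_mul_of_pos_left (by linarith) Real.pi_pos
  · rw [← Real.sin_add_nat_mul_pi, ← Real.cos_sub_pi_div_two]
    congr 1
    have hdiv : (N : ℝ) = n * (N / n : ℕ) + (N % n : ℕ) := by
      exact_mod_cast (Nat.div_add_mod N n).symm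
    have hN' : (N : ℝ) = i + j + shift n + k := by rw [hN]; push_cast; ring
    have hr : ((N % n : ℕ) : ℝ) = i + j + shift n + k - n * (N / n : ℕ) := by linarith
    rw [hr]
    unfold angle
    field_simp
    ring

/-- The lines `x cos u + y sin u = cos (3 u)`, tangent to a deltoid, for `n` equidistant angles
`u`. -/
noncomputable def deltoid (n : ℕ) : PseudolineArrangement n where
  curve i x := -(Real.cos (angle n i) / Real.sin (angle n i)) * x +
    Real.cos (3 * angle n i) / Real.sin (angle n i)
  continuous_curve i := by fun_prop
  cross i j hij := by
    apply crossExactlyOnce_lines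
    have hi := angle_mem i.2
    have hj := angle_mem j.2
    have hsi := Real.sin_pos_of_pos_of_lt_pi hi.1 hi.2
    have hsj := Real.sin_pos_of_pos_of_lt_pi hj.1 hj.2
    intro h
    rw [neg_inj, div_eq_div_iff hsi.ne' hsj.ne'] at h
    have h0 : Real.sin (angle n j - angle n i) = 0 := by
      rw [Real.sin_sub]; linarith
    rcases lt_or_gt_of_ne (Fin.val_ne_of_ne hij) with hlt | hlt
    · exact (sin_angle_sub_pos j.2 hlt).ne' h0
    · exact (sin_angle_sub_neg i.2 hlt).ne h0

theorem isLineArrangement_deltoid (n : ℕ) : (deltoid n).IsLineArrangement :=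
  fun _ => ⟨_, _, fun _ => rfl⟩

theorem deltoid_curve {n : ℕ} (i : Fin n) (x y : ℝ) :
    (y = (deltoid n).curve i x ↔ x * Real.cos (angle n i) + y * Real.sin (angle n i)
      - Real.cos (3 * angle n i) = 0) ∧
    ((deltoid n).curve i x < y ↔ 0 < x * Real.cos (angle n i) + y * Real.sin (angle n i)
      - Real.cos (3 * angle n i)) := by
  have hi := angle_mem i.2
  have hs := Real.sin_pos_of_pos_of_lt_pi hi.1 hi.2
  have h : x * Real.cos (angle n i) + y * Real.sin (angle n i) - Real.cos (3 * angle n i) =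
      Real.sin (angle n i) * (y - (deltoid n).curve i x) := by
    simp only [deltoid]
    field_simp
    ring
  rw [h]
  constructor
  · rw [mul_eq_zero, or_iff_right hs.ne', sub_eq_zero]
  · rw [mul_pos_iff_of_pos_left hs, sub_pos]

/-- The position of the line `k` relative to the crossing of the lines `i` and `j`. -/
theorem deltoid_position {n : ℕ} {i j : Fin n} (hij : i < j) {x : ℝ}
    (h : (deltoid n).curve i x = (deltoid n).curve j x) (k : Fin n) (hki : k ≠ i) (hkj : k ≠ j) :
    (deltoid n).curve i x ≠ (deltoid n).curve k x ∧
    ((deltoid n).curve k x < (deltoid n).curve i x ↔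
      ((k < i ∨ j < k) ↔ Even ((i + j + shift n + k : ℕ) / n))) := by
  have hn : 0 < n := i.pos
  have hs := sub_eq_zero.1 ((deltoid_curve i x ((deltoid n).curve i x)).1.1 rfl)
  have ht := sub_eq_zero.1 ((deltoid_curve j x ((deltoid n).curve i x)).1.1 h)
  have hid := tangent_identity (sin_angle_sub_pos j.2 hij).ne' hs ht (angle n k)
  obtain ⟨c, hc, hcos⟩ := cos_angle_add hn (i : ℕ) j k
  rw [hcos] at hid
  obtain ⟨h1, h2⟩ := deltoid_curve k x ((deltoid n).curve i x)
  rw [Ne, h1, h2, hid]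
  have hsign : ∀ N : ℕ, (Even N ∧ (-1 : ℝ) ^ N = 1) ∨ (¬ Even N ∧ (-1 : ℝ) ^ N = -1) := by
    intro N
    rcases Nat.even_or_odd N with hN | hN
    · exact Or.inl ⟨hN, hN.neg_one_pow⟩
    · exact Or.inr ⟨Nat.not_even_iff_odd.2 hN, hN.neg_one_pow⟩
  rcases lt_or_gt_of_ne hki with hk | hk
  · have ha := sin_angle_sub_neg i.2 (Fin.lt_def.1 hk)
    have hb := sin_angle_sub_neg j.2 (Fin.lt_def.1 (hk.trans hij))
    have hp : 0 < 4 * Real.sin (angle n k - angle n i) * Real.sin (angle n k - angle n j) * c :=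
      mul_pos (mul_pos_of_neg_of_neg (by linarith) hb) hc
    rcases hsign ((i + j + shift n + k : ℕ) / n) with ⟨he, hpow⟩ | ⟨he, hpow⟩ <;> rw [hpow]
    · exact ⟨by linarith, iff_of_true (by linarith) (iff_of_true (Or.inl hk) he)⟩
    · exact ⟨by linarith, iff_of_false (by linarith) fun h => he (h.1 (Or.inl hk))⟩
  rcases lt_or_gt_of_ne hkj with hk' | hk'
  · have ha := sin_angle_sub_pos k.2 (Fin.lt_def.1 hk)
    have hb := sin_angle_sub_neg j.2 (Fin.lt_def.1 hk')
    have hp : 4 * Real.sin (angle n k - angle n i) * Real.sin (angle n k - angle n j) * c < 0 :=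
      mul_neg_of_neg_of_pos (mul_neg_of_pos_of_neg (by linarith) hb) hc
    have hout : ¬ (k < i ∨ j < k) := by
      rintro (h | h)
      · exact lt_asymm h hk
      · exact lt_asymm h hk'
    rcases hsign ((i + j + shift n + k : ℕ) / n) with ⟨he, hpow⟩ | ⟨he, hpow⟩ <;> rw [hpow]
    · exact ⟨by linarith, iff_of_false (by linarith) fun h => hout (h.2 he)⟩
    · exact ⟨by linarith, iff_of_true (by linarith) (iff_of_false hout he)⟩
  · have ha := sin_angle_sub_pos k.2 (Fin.lt_def.1 hk)
    have hb := sin_angle_sub_pos k.2 (Fin.lt_def.1 hk')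
    have hp : 0 < 4 * Real.sin (angle n k - angle n i) * Real.sin (angle n k - angle n j) * c :=
      mul_pos (mul_pos (by linarith) hb) hc
    rcases hsign ((i + j + shift n + k : ℕ) / n) with ⟨he, hpow⟩ | ⟨he, hpow⟩ <;> rw [hpow]
    · exact ⟨by linarith, iff_of_true (by linarith) (iff_of_true (Or.inr hk') he)⟩
    · exact ⟨by linarith, iff_of_false (by linarith) fun h => he (h.1 (Or.inr hk'))⟩

theorem isSimple_deltoid (n : ℕ) : (deltoid n).IsSimple := by
  rintro i j k hij hik hjk ⟨x, h1, h2⟩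
  rcases lt_or_gt_of_ne hij with hlt | hlt
  · exact (deltoid_position hlt h1 k hik.symm hjk.symm).1 h2
  · exact (deltoid_position hlt h1.symm k hjk.symm hik.symm).1 (h1.symm.trans h2)

/-- For a crossing with a level of the rare parity, the sign of `cos (u + s + t)` changes, as `u` goes
from the angle `s` of `i` to the angle `t` of `j`. -/
theorem even_div_ne_of_crossingLevel {n : ℕ} {i j : Fin n} (hij : i < j)
    (he : (deltoid n).crossingLevel (i, j) % 2 = (n + shift n + 1) % 2) :
    ¬ (Even ((i + j + shift n + i : ℕ) / n) ↔ Even ((i + j + shift n + j : ℕ) / n)) := by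
  intro hiff
  have hn : 0 < n := i.pos
  set x := (deltoid n).crossing (i, j) with hx
  have hcross : (deltoid n).curve i x = (deltoid n).curve j x :=
    curve_crossing (A := deltoid n) (p := (i, j)) hij.ne
  have hcard : ((deltoid n).lower x ((deltoid n).curve i x)).card % 2 = (n + shift n) % 2 := by
    unfold crossingLevel at he
    simp only [← hx] at he
    omega
  have hpos := deltoid_position hij hcross
  set E : Fin n → ℕ := fun k => if Even ((i + j + shift n + k : ℕ) / n) then 1 else 0 with hE
  have hEsum : (∑ k, E k) % 2 = (n + (i + j + shift n)) % 2 := by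
    rw [← sum_even_div_mod_two hn (i + j + shift n), ← Fin.sum_univ_eq_sum_range]
  have hinside : ∑ k : Fin n, (if i < k ∧ k < j then 1 else 0) = (j : ℕ) - i - 1 := by
    rw [Finset.sum_boole, Nat.cast_id, ← Fin.card_Ioo]
    congr 1
    ext k
    simp
  have hlow : ∑ k : Fin n, (if k ∈ (deltoid n).lower x ((deltoid n).curve i x) then 1 else 0) =
      ((deltoid n).lower x ((deltoid n).curve i x)).card := by
    rw [Finset.sum_boole, Nat.cast_id]
    congr 1
    ext k
    simp
  -- summed over all lines other than `i` and `j`, the three indicators give an even number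
  have hterm : ∀ k : Fin n, ((if k ∈ (deltoid n).lower x ((deltoid n).curve i x) then 1 else 0)
      + E k + (if i < k ∧ k < j then 1 else 0)) % 2 =
      ((if k = i then E i else 0) + (if k = j then E j else 0)) % 2 := by
    intro k
    by_cases hki : k = i
    · subst hki
      simp [mem_lower, hij.ne]
    by_cases hkj : k = j
    · subst hkj
      simp [mem_lower, hcross, hij.ne']
    have hk := (hpos k hki hkj).2
    rw [if_neg hki, if_neg hkj]
    have hout : (k < i ∨ j < k) ↔ ¬ (i < k ∧ k < j) := by
      constructor
      · rintro (h | h) ⟨h1, h2⟩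
        · exact lt_asymm h h1
        · exact lt_asymm h h2
      · intro h
        by_contra hcon
        rw [not_or, not_lt, not_lt] at hcon
        exact h ⟨lt_of_le_of_ne hcon.1 (Ne.symm hki), lt_of_le_of_ne hcon.2 hkj⟩
    rw [hout] at hk
    simp only [mem_lower, hk, hE]
    by_cases h1 : i < k ∧ k < j <;> by_cases h2 : Even ((i + j + shift n + k : ℕ) / n) <;>
      simp [h1, h2]
  have hsum : (∑ k : Fin n, ((if k ∈ (deltoid n).lower x ((deltoid n).curve i x) then 1 else 0)
      + E k + (if i < k ∧ k < j then 1 else 0))) % 2 =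
      (∑ k : Fin n, ((if k = i then E i else 0) + (if k = j then E j else 0))) % 2 := by
    rw [Finset.sum_nat_mod, Finset.sum_congr rfl fun k _ => hterm k, ← Finset.sum_nat_mod]
  simp only [Finset.sum_add_distrib, hlow, hinside, Finset.sum_ite_eq', Finset.mem_univ,
    if_true] at hsum
  have hEij : E i = E j := by
    simp only [hE, hiff]
  have : (i : ℕ) < j := hij
  omega

/-- At most about a third of the crossings have levels of the rare parity: up to `n` exceptions, they
belong to increasing triples `i < m < j` such that `n` divides `i + m + j + shift n`. -/
theorem six_mul_card_crossings_le (n : ℕ) :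
    6 * ((pairs n).filter fun p =>
      (deltoid n).crossingLevel p % 2 = (n + shift n + 1) % 2).card ≤ n * n + 6 * n := by
  set S := (Finset.univ : Finset (Fin 3 → Fin n)).filter fun h : Fin 3 → Fin n =>
      StrictMono h ∧ n ∣ (∑ i, (h i : ℕ)) + shift n with hS
  set D := (Finset.univ : Finset (Fin n × Fin n)).filter fun p =>
      n ∣ (p.1 + p.2 + p.2 + shift n : ℕ) with hD
  have hDcard : D.card ≤ n := by
    have : D.card ≤ (Finset.univ : Finset (Fin n)).card := by
      refine Finset.card_le_card_of_injOn Prod.snd (by simp) ?_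
      rintro ⟨i, j⟩ hp ⟨i', j'⟩ hp' heq
      simp only [hD, Finset.mem_coe, Finset.mem_filter, Finset.mem_univ, true_and] at hp hp' heq
      subst heq
      have hmod : (j + j + shift n : ℕ) + (i : ℕ) ≡ (j + j + shift n : ℕ) + (i' : ℕ) [MOD n] := by
        refine ((Nat.modEq_zero_iff_dvd.2 ?_).trans (Nat.modEq_zero_iff_dvd.2 ?_).symm)
        · convert hp using 1; ring
        · convert hp' using 1; ring
      have := Nat.ModEq.add_left_cancel' _ hmod
      rw [Fin.ext (Nat.ModEq.eq_of_lt_of_lt this i.2 i'.2)]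
    simpa using this
  have hsub : ((pairs n).filter fun p =>
      (deltoid n).crossingLevel p % 2 = (n + shift n + 1) % 2) ⊆
      S.image (fun h => (h 0, h 2)) ∪ D := by
    rintro ⟨i, j⟩ hp
    simp only [Finset.mem_filter, pairs, Finset.mem_univ, true_and] at hp
    obtain ⟨hij, hp⟩ := hp
    have hne := even_div_ne_of_crossingLevel hij hp
    have hn : 0 < n := i.pos
    have hlt : (i : ℕ) < j := hij
    set q₁ := (i + j + shift n + i : ℕ) / n with hq₁
    set q₂ := (i + j + shift n + j : ℕ) / n with hq₂
    have hle : q₁ ≤ q₂ := Nat.div_le_div_right (by omega)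
    have hq : q₁ < q₂ := lt_of_le_of_ne hle fun h => hne (by rw [h])
    have h1 : n * q₂ ≤ i + j + shift n + j := Nat.mul_div_le _ _
    have h2 : (i + j + shift n + i : ℕ) < n * q₂ :=
      (Nat.lt_mul_div_succ _ hn).trans_le (Nat.mul_le_mul_left n hq)
    -- the multiple `n * q₂` of `n` is the sum of `i + j + shift n` and some `m` with `i < m ≤ j`
    obtain ⟨m, hm⟩ : ∃ m, n * q₂ = i + j + shift n + m := ⟨n * q₂ - (i + j + shift n), by omega⟩
    rw [Finset.mem_union]
    rcases lt_or_eq_of_le (by omega : m ≤ j) with hmj | rfl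
    · left
      have hj := j.2
      refine Finset.mem_image.2 ⟨![i, ⟨m, by omega⟩, j], ?_, rfl⟩
      rw [hS, Finset.mem_filter]
      refine ⟨Finset.mem_univ _, ?_, ?_⟩
      · rw [Fin.strictMono_iff_lt_succ]
        intro l
        fin_cases l
        · exact Fin.lt_def.2 (by simp; omega)
        · exact Fin.lt_def.2 (by simpa using hmj)
      · rw [Fin.sum_univ_three]
        refine ⟨q₂, ?_⟩
        rw [hm]
        simp
        omega
    · right
      rw [hD, Finset.mem_filter]
      exact ⟨Finset.mem_univ _, ⟨q₂, by rw [hm]; simp only; omega⟩⟩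
  have h1 := (Finset.card_le_card hsub).trans (Finset.card_union_le _ _)
  have h2 : (S.image fun h => (h 0, h 2)).card ≤ S.card := Finset.card_image_le
  have h3 : 6 * S.card ≤ n * n := by
    rw [hS]
    convert six_mul_card_strictMono_le n (shift n)
  omega

theorem length_dualPath_deltoid_le {n : ℕ} (hn : 1 ≤ n) {P : List (deltoid n).Face}
    (hP : (deltoid n).IsDualPath P) : (P.length : ℝ) ≤ (n : ℝ) ^ 2 / 3 + 7 * n := by
  have h1 := length_dualPath_le (isSimple_deltoid n) ((n + shift n + 1) % 2) (by omega) hP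
  have h2 := six_mul_card_crossings_le n
  have h3 : 3 * P.length ≤ n * n + 21 * n := by omega
  have h4 : (3 : ℝ) * P.length ≤ n * n + 21 * n := by exact_mod_cast h3
  nlinarith

end PseudolineArrangement

theorem theorem1 :
    -- every simple arrangement of `n` pseudolines has a dual path of length `n² / 3 - O(n)`
    (∃ C : ℝ, ∀ (n : ℕ) (A : PseudolineArrangement n), A.IsSimple →
      ∃ P : List A.Face, A.IsDualPath P ∧ (n : ℝ) ^ 2 / 3 - C * n ≤ (P.length : ℝ)) ∧
    -- it has exponentially many dual paths of length `Ω(n²)`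
    (∃ c : ℝ, 0 < c ∧ ∃ b : ℝ, 1 < b ∧ ∃ n₀ : ℕ,
      ∀ (n : ℕ) (A : PseudolineArrangement n), n₀ ≤ n → A.IsSimple →
        ∃ S : Finset (List A.Face),
          (∀ P ∈ S, A.IsDualPath P ∧ c * (n : ℝ) ^ 2 ≤ (P.length : ℝ)) ∧ b ^ n ≤ (S.card : ℝ)) ∧
    -- tightness, already for straight lines
    (∃ C : ℝ, ∀ n : ℕ, 1 ≤ n →
      ∃ A : PseudolineArrangement n, A.IsSimple ∧ A.IsLineArrangement ∧
        ∀ P : List A.Face, A.IsDualPath P → (P.length : ℝ) ≤ (n : ℝ) ^ 2 / 3 + C * n) :=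
  ⟨⟨5, fun _ _ hA => PseudolineArrangement.exists_long_dualPath hA⟩,
    ⟨1 / 12, by norm_num, 21 / 20, by norm_num, 60, fun _ _ hn hA =>
      PseudolineArrangement.exists_many_dualPaths hA hn⟩,
    ⟨7, fun n hn => ⟨.deltoid n, PseudolineArrangement.isSimple_deltoid n,
      PseudolineArrangement.isLineArrangement_deltoid n,
      fun _ hP => PseudolineArrangement.length_dualPath_deltoid_le hn hP⟩⟩⟩
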